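/- **Setting.** Let $\{e_t\}_{t\in\mathbb Z}$ be independent (not necessarily identically distributed) random elements of a measurable space, and let $\{e_t^\dagger\}_{t\in\mathbb Z}$ be an independent copy: all the $e_t$, $e^\dagger_s$ are jointly independent and $e_t^\dagger$ has the law of $e_t$. For every sample size $T\ge 1$ let $d=d_T$ be a dimension and $$\epsilon_t=\epsilon_{t,T}=g_{t,T}(\dots,e_{t-1},e_t)\in\mathbb R^{d},\qquad t\in\mathbb Z,$$ with measurable $g_{t,T}$. For $s\ge 0$ let $\epsilon_t(s)$ be $\epsilon_t$ with $e_{t-s}$ replaced by $e_{t-s}^\dagger$, and put $\|X\|_m=(\mathbf E|X|^m)^{1/m}$ and $$\delta_s=\delta_{s,T}=\sup_{t\in\mathbb Z,\ |a|_2=1}\big\|a^\top(\epsilon_t-\epsilon_t(s))\big\|_M .$$ The process is called $(M,\alpha)$-short-range dependent if $\mathbf E[\epsilon_t]=0$ for all $t$ and, with bounds uniform in $T$, $$\sup_{t\in\mathbb Z,\ |a|_2=1}\|a^\top\epsilon_t\|_M=O(1),\qquad \sup_{s\ge 0}\,(1+s)^\alpha\sum_{j=s}^\infty\delta_j=O(1).$$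 For an integer $a\ge0$ let $\mathcal F_{t,a}$ be the $\sigma$-field generated by $e_t,e_{t-1},\dots,e_{t-a}$. **Theorem.** Let $\epsilon_t$ be $(M,\alpha)$-short-range dependent with $M>4$ and $\alpha>4$, and let $d\asymp T$, i.e. $c_1T\le d_T\le c_2T$ for all $T\ge1$ with constants $c_1,c_2>0$. Then there is a constant $C>0$, not depending on $T$, $B$, $\ell$ or the coefficients, such that the following holds for all integers $B=B_T>1$ with $T^{2/\alpha}=o(B)$ as $T\to\infty$ and all real coefficients $b_{t_1t_2}=b_{t_1t_2,T}$, $1\le t_1,t_2\le T$, with $|b_{t_1t_2}|\le1$ and $b_{t_1t_2}=0$ whenever $|t_1-t_2|<B$. 1. For every $T\ge1$, the quadratic form $Q=\sum_{t_1=1}^T\sum_{t_2=1}^T b_{t_1t_2}\big(\epsilon_{t_1}^\top\epsilon_{t_2}-\mathbf E[\epsilon_{t_1}^\top\epsilon_{t_2}]\big)$ satisfies $$\|Q\|_{M/2}\le C\left(\sqrt{d\sum_{t_1=1}^T\sum_{t_2=1}^T b_{t_1t_2}^2}+\frac{T^{5/2}}{B^{\alpha}}+\frac{T^{3/2}}{B^{\alpha-2}}\right).$$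 2. For every $T\ge1$ and every integer $\ell\ge B$, $$\Big\|\sum_{t_1=1}^T\sum_{t_2=1}^T b_{t_1t_2}\big(\epsilon_{t_1}^\top\epsilon_{t_2}-\mathbf E[\epsilon_{t_1}^\top\epsilon_{t_2}\mid\mathcal F_{t_1\vee t_2,\ell}]\big)\Big\|_{M/2} \le C\sum_{q=1}^\infty\delta_q\sqrt{d\sum_{B\vee(\ell+1-q)\le|t_1-t_2|\le\ell} b_{t_1t_2}^2} +C\sqrt{d\sum_{|t_1-t_2|\ge\ell+1}b_{t_1t_2}^2}+\frac{C\,d\,T^{3/2}}{\ell^{\alpha-1}}+\frac{C\,d\sqrt T}{B^{\alpha}},$$ where the sums of squares run over $1\le t_1,t_2\le T$. -/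

import Mathlib

open MeasureTheory ProbabilityTheory Filter Asymptotics
open scoped ENNReal NNReal

noncomputable section

/-- The past `(e_t, e_{t-1}, e_{t-2}, …)` of the innovations; position `j` holds `e_{t-j}`. -/
def pastSeq {Ω S : Type*} (e : ℤ → Ω → S) (t : ℤ) (ω : Ω) : ℕ → S :=
  fun j => e (t - j) ω

/-- The past at time `t`, with `e_{t-s}` replaced by the independent copy `e†_{t-s}`. -/
def switchedSeq {Ω S : Type*} (e eDag : ℤ → Ω → S) (t : ℤ) (s : ℕ) (ω : Ω) : ℕ → S :=
  Function.update (pastSeq e t ω) s (eDag (t - s) ω)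

/-- The vector time series `ε_t = g_t(…, e_{t-1}, e_t)`. -/
def proc {Ω S : Type*} {d : ℕ} (e : ℤ → Ω → S)
    (g : ℤ → (ℕ → S) → EuclideanSpace ℝ (Fin d)) (t : ℤ) (ω : Ω) : EuclideanSpace ℝ (Fin d) :=
  g t (pastSeq e t ω)

/-- The coupled series `ε_t(s) = g_t(…, e_{t-s-1}, e†_{t-s}, e_{t-s+1}, …, e_t)`, `s ≥ 0`. -/
def procSwitched {Ω S : Type*} {d : ℕ} (e eDag : ℤ → Ω → S)
    (g : ℤ → (ℕ → S) → EuclideanSpace ℝ (Fin d)) (s : ℕ) (t : ℤ) (ω : Ω) :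
    EuclideanSpace ℝ (Fin d) :=
  g t (switchedSeq e eDag t s ω)

/-- The dependence measure `δ_s = sup_{t, |a|₂ = 1} ‖aᵀ(ε_t - ε_t(s))‖_M`, in `[0, ∞]`. -/
def depDelta {Ω S : Type*} [MeasurableSpace Ω] {d : ℕ} (μ : Measure Ω) (M : ℝ)
    (e eDag : ℤ → Ω → S) (g : ℤ → (ℕ → S) → EuclideanSpace ℝ (Fin d)) (s : ℕ) : ℝ≥0∞ :=
  ⨆ (t : ℤ) (a : EuclideanSpace ℝ (Fin d)) (_ : ‖a‖ = 1),
    eLpNorm (fun ω => inner ℝ a (proc e g t ω - procSwitched e eDag g s t ω))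
      (ENNReal.ofReal M) μ

/-- `e` is a sequence of independent random elements and `eDag` is an independent copy of it
(the laws may vary with `t`). -/
structure IsInnovationPair {Ω S : Type*} [MeasurableSpace Ω] [MeasurableSpace S]
    (μ : Measure Ω) (e eDag : ℤ → Ω → S) : Prop where
  measurable_e : ∀ t, Measurable (e t)
  measurable_eDag : ∀ t, Measurable (eDag t)
  indep : iIndepFun (Sum.elim e eDag) μ
  identDistrib : ∀ t, IdentDistrib (eDag t) (e t) μ μ

/-- `(M, α)`-short-range dependence of the array `ε_t = ε_{t,T} = g_{t,T}(…, e_{t-1}, e_t)`,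
`t ∈ ℤ`, of dimension `d T` at sample size `T ≥ 1`; the two `O(1)` bounds are uniform in `T`. -/
structure IsShortRangeDependent {Ω S : Type*} [MeasurableSpace Ω] [MeasurableSpace S]
    (μ : Measure Ω) (M α : ℝ) (e eDag : ℤ → Ω → S) (d : ℕ → ℕ)
    (g : (T : ℕ) → ℤ → (ℕ → S) → EuclideanSpace ℝ (Fin (d T))) : Prop where
  innovations : IsInnovationPair μ e eDag
  measurable_g : ∀ T, 1 ≤ T → ∀ t, Measurable (g T t)
  mean_zero : ∀ T, 1 ≤ T → ∀ t, ∫ ω, proc e (g T) t ω ∂μ = 0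
  moment_bound : ∃ K : ℝ≥0, ∀ T, 1 ≤ T →
    (⨆ (t : ℤ) (a : EuclideanSpace ℝ (Fin (d T))) (_ : ‖a‖ = 1),
      eLpNorm (fun ω => inner ℝ a (proc e (g T) t ω)) (ENNReal.ofReal M) μ) ≤ K
  dependence_bound : ∃ K : ℝ≥0, ∀ T, 1 ≤ T →
    (⨆ s : ℕ, ENNReal.ofReal ((1 + s : ℝ) ^ α) *
      ∑' j : ℕ, depDelta μ M e eDag (g T) (s + j)) ≤ K

/-- The σ-field `F_{t,a}` generated by `e_t, e_{t-1}, …, e_{t-a}`. -/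
abbrev innovSigma {Ω S : Type*} [mS : MeasurableSpace S] (e : ℤ → Ω → S) (t : ℤ) (a : ℕ) :
    MeasurableSpace Ω :=
  ⨆ (j : ℕ) (_ : j ≤ a), mS.comap (e (t - j))

/-- The centered quadratic form `Q = ∑ b_{t₁t₂} (ε_{t₁}ᵀ ε_{t₂} - E[ε_{t₁}ᵀ ε_{t₂}])`. -/
def quadForm {Ω : Type*} [MeasurableSpace Ω] {d : ℕ} (μ : Measure Ω)
    (ε : ℤ → Ω → EuclideanSpace ℝ (Fin d)) (b : ℤ → ℤ → ℝ) (T : ℕ) (ω : Ω) : ℝ :=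
  ∑ t₁ ∈ Finset.Icc (1 : ℤ) T, ∑ t₂ ∈ Finset.Icc (1 : ℤ) T,
    b t₁ t₂ * (inner ℝ (ε t₁ ω) (ε t₂ ω) - ∫ ω', inner ℝ (ε t₁ ω') (ε t₂ ω') ∂μ)

/-- `∑ b_{t₁t₂} (ε_{t₁}ᵀ ε_{t₂} - E[ε_{t₁}ᵀ ε_{t₂} | F_{t₁ ∨ t₂, ℓ}])`. -/
def quadFormTruncError {Ω S : Type*} [MeasurableSpace Ω] [MeasurableSpace S] {d : ℕ}
    (μ : Measure Ω) (e : ℤ → Ω → S) (ε : ℤ → Ω → EuclideanSpace ℝ (Fin d))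
    (b : ℤ → ℤ → ℝ) (T l : ℕ) (ω : Ω) : ℝ :=
  ∑ t₁ ∈ Finset.Icc (1 : ℤ) T, ∑ t₂ ∈ Finset.Icc (1 : ℤ) T,
    b t₁ t₂ * (inner ℝ (ε t₁ ω) (ε t₂ ω) -
      (μ[fun ω' => (inner ℝ (ε t₁ ω') (ε t₂ ω') : ℝ) | innovSigma e (max t₁ t₂) l]) ω)

/-- The sum of `b_{t₁t₂}²` over `1 ≤ t₁, t₂ ≤ T` with `P |t₁ - t₂|`. -/
def sumSqLag (b : ℤ → ℤ → ℝ) (T : ℕ) (P : ℤ → Prop) [DecidablePred P] : ℝ :=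
  ∑ t₁ ∈ Finset.Icc (1 : ℤ) T, ∑ t₂ ∈ Finset.Icc (1 : ℤ) T,
    if P |t₁ - t₂| then b t₁ t₂ ^ 2 else 0

/-- Admissible bandwidths `B = B_T` and coefficients `b_{t₁t₂} = b_{t₁t₂,T}`. -/
structure IsAdmissible (α : ℝ) (B : ℕ → ℕ) (b : ℕ → ℤ → ℤ → ℝ) : Prop where
  one_lt : ∀ T, 1 ≤ T → 1 < B T
  bandwidth : (fun T : ℕ => (T : ℝ) ^ (2 / α)) =o[atTop] (fun T : ℕ => (B T : ℝ))
  abs_le_one : ∀ T : ℕ, ∀ t₁ ∈ Finset.Icc (1 : ℤ) T, ∀ t₂ ∈ Finset.Icc (1 : ℤ) T, |b T t₁ t₂| ≤ 1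
  eq_zero : ∀ T : ℕ, ∀ t₁ ∈ Finset.Icc (1 : ℤ) T, ∀ t₂ ∈ Finset.Icc (1 : ℤ) T,
    |t₁ - t₂| < (B T : ℤ) → b T t₁ t₂ = 0

end

noncomputable section

/-! Since the coefficients vanish near the diagonal, the form splits into two triangular parts, and
by symmetry it is enough to treat lags `t₂ - t₁ ≥ B`. There the innovations shared by the two
factors lie at least `B` steps before `t₂`, so `ε_{t₂}` may be replaced by its conditional
expectation given the last `n` innovations (`winExp`), with `n = B` for the first bound and `n = ℓ +
1` for the second. Hölder's inequality and the moments of linear sums bound the price by `d T^{3/2}`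
times the tail of `δ` beyond `n`, which is `O(n^{-α})` (`eLpNorm_sum_remainder_le`).

The first factor is telescoped into increments of window expectations. The `q`-th increment at time
`t` is the effect of revealing `e_{t-q}`, and coupling bounds it by `δ_q` in every fixed direction
(`eLpNorm_inner_condExp_sub_le`). It has mean zero given all innovations after `t - q`. Hence, for
fixed `q`, its products with functions of those innovations are martingale differences when time
runs backwards, and a Burkholder-type inequality in `L^{M/2}` (`sq_eLpNorm_sum_backward_le`) yields
a sum of squares over `t₁`. The inner sum over `t₂` is linear and is handled in the same way in
`L^M`. When the second factor uses only innovations after `t₁`, it is independent of the increment;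
conditioning on it leaves only the directional size `δ_q` (`eLpNorm_inner_le_of_indepFun`). This
saves a factor `√d` and gives the main terms.

For the second bound, conditioning on the window of `ℓ + 1` innovations ending at `t₂` shortens the
past of `ε_{t₁}` to length `(ℓ + 1 - (t₂ - t₁))⁺`, so only increments with `q ≥ ℓ + 1 - (t₂ - t₁)`
survive. Lags beyond `ℓ` give independent factors. At shorter lags the window at `t₂` is cut at
length `B`: the recent part is again independent, and the older part is treated by Cauchy–Schwarz.
The latter costs `d √T B^{-α}`, because each row has at most `q` relevant lags and `∑ δ_q √q`
converges. -/

/-! ### A moment inequality for martingale sums. -/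

/-- The tangent of `x ^ r` at `1 + u` lies below the value at `x = 1`. This is Bernoulli's
inequality at `-u / (1 + u)`, rescaled. -/
theorem one_add_rpow_le_tangent {r u : ℝ} (hr : 1 ≤ r) (hu : -1 < u) :
    (1 + u) ^ r ≤ 1 + r * u * (1 + u) ^ (r - 1) := by
  have h1 : 0 < 1 + u := by linarith
  have hb := one_add_mul_self_le_rpow_one_add (s := -u / (1 + u)) (p := r) (by
    rw [le_div_iff₀ h1]; linarith) hr
  have h2 : 1 + -u / (1 + u) = (1 + u)⁻¹ := by field_simp; ring
  rw [h2, Real.inv_rpow h1.le] at hb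
  have h3 : 0 < (1 + u) ^ r := Real.rpow_pos_of_pos h1 r
  have h4 := mul_le_mul_of_nonneg_right hb h3.le
  rw [inv_mul_cancel₀ h3.ne'] at h4
  rw [Real.rpow_sub_one h1.ne']
  have h5 : (1 + r * (-u / (1 + u))) * (1 + u) ^ r
      = (1 + u) ^ r - r * u * ((1 + u) ^ r / (1 + u)) := by field_simp; ring
  linarith

/-- The constant of the second-order smoothness inequality for `|x| ^ p`. -/
def smoothConst (p : ℝ) : ℝ := 3 ^ p + 2 * p + p * ((p - 1) * 2 ^ p)

theorem smoothConst_ge_one {p : ℝ} (hp : 2 ≤ p) : 1 ≤ smoothConst p := by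
  have h1 : (1 : ℝ) ≤ 3 ^ p := Real.one_le_rpow (by norm_num) (by linarith)
  have h2 : (0 : ℝ) < 2 ^ p := by positivity
  have h3 : 0 ≤ p * ((p - 1) * 2 ^ p) :=
    mul_nonneg (by linarith) (mul_nonneg (by linarith) h2.le)
  unfold smoothConst
  linarith

/-- Each summand of `smoothConst` has one role: `p * ((p - 1) * 2 ^ p)` bounds the second-order
Taylor remainder for `|u| ≤ 1/2`; for larger `u`, `3 ^ p` comes from `|1 + u| ≤ 3 |u|` and `2 * p`
absorbs a negative linear term. -/
theorem abs_one_add_rpow_le {p : ℝ} (hp : 2 ≤ p) (u : ℝ) :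
    |1 + u| ^ p ≤ 1 + p * u + smoothConst p * (u ^ 2 + |u| ^ p) := by
  have hp0 : 0 ≤ p := by linarith
  have hpow : (0 : ℝ) < 2 ^ p := by positivity
  have h3 : (0 : ℝ) < 3 ^ p := by positivity
  have hK : 0 ≤ p * ((p - 1) * 2 ^ p) :=
    mul_nonneg (by linarith) (mul_nonneg (by linarith) hpow.le)
  have hup : 0 ≤ |u| ^ p := by positivity
  have hu2 := sq_nonneg u
  unfold smoothConst
  rcases le_or_gt |u| (1 / 2) with h | h
  · have hu := abs_le.1 h
    have h1 : 0 < 1 + u := by linarith [hu.1]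
    rw [abs_of_pos h1]
    have ht := one_add_rpow_le_tangent (r := p) (u := u) (by linarith) (by linarith)
    have key : u * (1 + u) ^ (p - 1) ≤ u + (p - 1) * 2 ^ p * u ^ 2 := by
      rcases le_total 0 u with h0 | h0
      · have h4 := one_add_rpow_le_tangent (r := p - 1) (u := u) (by linarith) (by linarith)
        have h5 : (1 + u) ^ (p - 1 - 1) ≤ 2 ^ p :=
          (Real.rpow_le_rpow h1.le (by linarith) (by linarith)).trans
            (Real.rpow_le_rpow_of_exponent_le (by norm_num) (by linarith))
        have h6 : (1 + u) ^ (p - 1) ≤ 1 + (p - 1) * u * 2 ^ p :=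
          h4.trans (by
            have : 0 ≤ (p - 1) * u := mul_nonneg (by linarith) h0
            have := mul_le_mul_of_nonneg_left h5 this
            linarith)
        nlinarith
      · have h4 := one_add_mul_self_le_rpow_one_add (s := u) (p := p - 1) (by linarith)
          (by linarith)
        have h5 : (1 : ℝ) ≤ 2 ^ p := Real.one_le_rpow (by norm_num) (by linarith)
        have h6 : 0 ≤ (p - 1) * u ^ 2 := mul_nonneg (by linarith) hu2
        nlinarith
    have key2 := mul_le_mul_of_nonneg_left key hp0
    have h7 : 0 ≤ (3 ^ p + 2 * p) * (u ^ 2 + |u| ^ p) := by positivity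
    have h8 : 0 ≤ p * ((p - 1) * 2 ^ p) * |u| ^ p := by positivity
    nlinarith
  · have h1 : |1 + u| ≤ 3 * |u| := by
      have := abs_add_le 1 u
      rw [abs_one] at this
      linarith
    have h2 : |1 + u| ^ p ≤ 3 ^ p * |u| ^ p := by
      rw [← Real.mul_rpow (by norm_num) (abs_nonneg u)]
      exact Real.rpow_le_rpow (abs_nonneg _) h1 hp0
    have h4 : -u ≤ 2 * u ^ 2 := by
      have := neg_abs_le u
      have h5 : u ^ 2 = |u| ^ 2 := (sq_abs u).symm
      nlinarith
    have h9 : 0 ≤ 3 ^ p * u ^ 2 := by positivity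
    have h10 : 0 ≤ 2 * p * |u| ^ p := by positivity
    have h11 : 0 ≤ p * ((p - 1) * 2 ^ p) * (u ^ 2 + |u| ^ p) :=
      mul_nonneg hK (by positivity)
    nlinarith

/-- Homogeneous form of the preceding bound. When `y` is a martingale difference the linear term
integrates to zero, leaving terms of second order and higher in `y`. -/
theorem abs_add_rpow_le {p : ℝ} (hp : 2 ≤ p) (x y : ℝ) :
    |x + y| ^ p ≤ |x| ^ p + p * (|x| ^ (p - 2) * x * y)
      + smoothConst p * (|x| ^ (p - 2) * |y| ^ (2 : ℝ) + |y| ^ p) := by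
  have hC := smoothConst_ge_one hp
  rcases eq_or_ne x 0 with rfl | hx
  · have h1 : 0 ≤ |y| ^ p := by positivity
    have h2 : 0 ≤ |(0 : ℝ)| ^ (p - 2) * |y| ^ (2 : ℝ) := by positivity
    rw [zero_add, abs_zero, Real.zero_rpow (by linarith : p ≠ 0)]
    rw [abs_zero] at h2
    nlinarith
  · have hx' : 0 < |x| := abs_pos.2 hx
    have h := mul_le_mul_of_nonneg_left (abs_one_add_rpow_le hp (y / x))
      (by positivity : 0 ≤ |x| ^ p)
    have e1 : |x| ^ p * |1 + y / x| ^ p = |x + y| ^ p := by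
      rw [← Real.mul_rpow (abs_nonneg _) (abs_nonneg _), ← abs_mul]
      congr 2
      field_simp
    have e2 : |x| ^ p * |y / x| ^ p = |y| ^ p := by
      rw [← Real.mul_rpow (abs_nonneg _) (abs_nonneg _), ← abs_mul]
      congr 2
      field_simp
    have e3 : |x| ^ p = |x| ^ (p - 2) * x ^ 2 := by
      rw [Real.rpow_sub hx', Real.rpow_two, sq_abs]
      field_simp
    have e4 : |y| ^ (2 : ℝ) = y ^ 2 := by rw [Real.rpow_two, sq_abs]
    rw [e1] at h
    refine h.trans (le_of_eq ?_)
    have : |x| ^ p * (1 + p * (y / x) + smoothConst p * ((y / x) ^ 2 + |y / x| ^ p))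
      = |x| ^ p + p * (|x| ^ p * (y / x))
        + smoothConst p * (|x| ^ p * (y / x) ^ 2 + |x| ^ p * |y / x| ^ p) := by ring
    rw [this, e2, e4]
    have e5 : |x| ^ p * (y / x) = |x| ^ (p - 2) * x * y := by rw [e3]; field_simp
    have e6 : |x| ^ p * (y / x) ^ 2 = |x| ^ (p - 2) * y ^ 2 := by rw [e3]; field_simp
    rw [e5, e6]

/-- The constant of the martingale moment inequality. -/
def martConst (p : ℝ) : ℝ≥0 := ⟨√(2 * |smoothConst p|), Real.sqrt_nonneg _⟩

/-- With `q = p / 2` and `s`, `x` squared `L^p` norms, this turns a bound on `p`-th moments into an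
additive recursion for squared norms. -/
theorem rpow_add_bound {q s x C : ℝ} (hq : 1 ≤ q) (hs : 0 ≤ s) (hx : 0 ≤ x) (hC : 1 ≤ C) :
    s ^ q + C * (s ^ (q - 1) * x + x ^ q) ≤ (s + 2 * C * x) ^ q := by
  have h2 : ∀ z : ℝ, 0 ≤ z → z ^ q = z * z ^ (q - 1) := by
    intro z hz
    rcases hz.eq_or_lt with rfl | hz
    · rw [Real.zero_rpow (by linarith)]; simp
    · rw [Real.rpow_sub_one hz.ne']; field_simp
  have hCx : 0 ≤ 2 * C * x := by positivity
  have h3 : s ^ (q - 1) ≤ (s + 2 * C * x) ^ (q - 1) :=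
    Real.rpow_le_rpow hs (by linarith) (by linarith)
  have h4 : x ^ (q - 1) ≤ (s + 2 * C * x) ^ (q - 1) :=
    Real.rpow_le_rpow hx (by nlinarith) (by linarith)
  rw [h2 s hs, h2 x hx, h2 _ (by positivity : 0 ≤ s + 2 * C * x)]
  have h5 := mul_le_mul_of_nonneg_left h3 hs
  have h6 := mul_le_mul_of_nonneg_left h3 (by positivity : 0 ≤ C * x)
  have h7 := mul_le_mul_of_nonneg_left h4 (by positivity : 0 ≤ C * x)
  nlinarith

theorem integral_rpow_mul_rpow_le {Ω : Type*} [MeasurableSpace Ω] {μ : Measure Ω}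
    {f g : Ω → ℝ} (hf : Integrable f μ) (hg : Integrable g μ) (hf0 : 0 ≤ f) (hg0 : 0 ≤ g)
    {a b : ℝ} (ha : 0 ≤ a) (hb : 0 ≤ b) (hab : a + b = 1) :
    Integrable (fun ω => f ω ^ a * g ω ^ b) μ ∧
      ∫ ω, f ω ^ a * g ω ^ b ∂μ ≤ (∫ ω, f ω ∂μ) ^ a * (∫ ω, g ω ∂μ) ^ b := by
  have hH := ENNReal.lintegral_mul_norm_pow_le (μ := μ) (f := fun ω => ENNReal.ofReal (f ω))
    (g := fun ω => ENNReal.ofReal (g ω)) hf.1.aemeasurable.ennreal_ofReal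
    hg.1.aemeasurable.ennreal_ofReal ha hb hab
  have e : ∀ ω, ENNReal.ofReal (f ω) ^ a * ENNReal.ofReal (g ω) ^ b
      = ENNReal.ofReal (f ω ^ a * g ω ^ b) := fun ω => by
    rw [ENNReal.ofReal_rpow_of_nonneg (hf0 ω) ha, ENNReal.ofReal_rpow_of_nonneg (hg0 ω) hb,
      ENNReal.ofReal_mul (Real.rpow_nonneg (hf0 ω) _)]
  simp_rw [e] at hH
  rw [← ofReal_integral_eq_lintegral_ofReal hf (ae_of_all _ hf0),
    ← ofReal_integral_eq_lintegral_ofReal hg (ae_of_all _ hg0),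
    ENNReal.ofReal_rpow_of_nonneg (integral_nonneg hf0) ha,
    ENNReal.ofReal_rpow_of_nonneg (integral_nonneg hg0) hb,
    ← ENNReal.ofReal_mul (Real.rpow_nonneg (integral_nonneg hf0) _)] at hH
  have hmeas : AEStronglyMeasurable (fun ω => f ω ^ a * g ω ^ b) μ :=
    ((hf.1.aemeasurable.pow_const a).mul (hg.1.aemeasurable.pow_const b)).aestronglyMeasurable
  have hnn : ∀ ω, 0 ≤ f ω ^ a * g ω ^ b := fun ω =>
    mul_nonneg (Real.rpow_nonneg (hf0 ω) _) (Real.rpow_nonneg (hg0 ω) _)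
  have hint : Integrable (fun ω => f ω ^ a * g ω ^ b) μ := by
    refine ⟨hmeas, ?_⟩
    rw [hasFiniteIntegral_iff_ofReal (ae_of_all _ hnn)]
    exact hH.trans_lt ENNReal.ofReal_lt_top
  refine ⟨hint, ?_⟩
  rw [← ofReal_integral_eq_lintegral_ofReal hint (ae_of_all _ hnn)] at hH
  exact (ENNReal.ofReal_le_ofReal_iff (mul_nonneg (Real.rpow_nonneg (integral_nonneg hf0) _)
    (Real.rpow_nonneg (integral_nonneg hg0) _))).1 hH

theorem MeasureTheory.MemLp.sq_eLpNorm_eq {Ω : Type*} [MeasurableSpace Ω] {μ : Measure Ω} {p : ℝ}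
    (hp : 0 < p) {f : Ω → ℝ} (hf : MemLp f (ENNReal.ofReal p) μ) :
    eLpNorm f (ENNReal.ofReal p) μ ^ 2 = ENNReal.ofReal ((∫ ω, |f ω| ^ p ∂μ) ^ (2 / p)) := by
  have h0 : 0 ≤ ∫ ω, |f ω| ^ p ∂μ := integral_nonneg fun ω => by positivity
  rw [hf.eLpNorm_eq_integral_rpow_norm (by simpa using hp) ENNReal.ofReal_ne_top,
    ENNReal.toReal_ofReal hp.le, ← ENNReal.ofReal_pow (by positivity)]
  congr 1
  simp only [Real.norm_eq_abs]
  rw [← Real.rpow_natCast, ← Real.rpow_mul h0]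
  congr 1
  push_cast
  field_simp

theorem MeasureTheory.MemLp.integrable_abs_rpow {Ω : Type*} [MeasurableSpace Ω] {μ : Measure Ω}
    {p : ℝ} (hp : 0 < p) {f : Ω → ℝ} (hf : MemLp f (ENNReal.ofReal p) μ) :
    Integrable (fun ω => |f ω| ^ p) μ := by
  simpa [ENNReal.toReal_ofReal hp.le] using
    hf.integrable_norm_rpow (by simpa using hp) ENNReal.ofReal_ne_top

/-- One step of the martingale moment inequality. -/
theorem sq_eLpNorm_add_le {Ω : Type*} {G m0 : MeasurableSpace Ω} {μ : Measure Ω}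
    [IsProbabilityMeasure μ] {p : ℝ} (hp : 2 ≤ p) (hG : G ≤ m0)
    {S X : Ω → ℝ} (hS : MemLp S (ENNReal.ofReal p) μ) (hX : MemLp X (ENNReal.ofReal p) μ)
    (hSG : AEStronglyMeasurable[G] S μ) (hXG : μ[X | G] =ᵐ[μ] 0) :
    eLpNorm (S + X) (ENNReal.ofReal p) μ ^ 2 ≤
      eLpNorm S (ENNReal.ofReal p) μ ^ 2
        + (martConst p : ℝ≥0∞) ^ 2 * eLpNorm X (ENNReal.ofReal p) μ ^ 2 := by
  have hp0 : 0 < p := by linarith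
  have hC := smoothConst_ge_one hp
  have hp1 : (1 : ℝ≥0∞) ≤ ENNReal.ofReal p := by
    rw [← ENNReal.ofReal_one]; exact ENNReal.ofReal_le_ofReal (by linarith)
  have hSi := hS.integrable_abs_rpow hp0
  have hXi := hX.integrable_abs_rpow hp0
  have hSXi := (hS.add hX).integrable_abs_rpow hp0
  have hS0 : (0 : Ω → ℝ) ≤ fun ω => |S ω| ^ p := fun ω => by positivity
  have hX0 : (0 : Ω → ℝ) ≤ fun ω => |X ω| ^ p := fun ω => by positivity
  obtain ⟨i1, l1⟩ := integral_rpow_mul_rpow_le hSi hXi hS0 hX0 (a := (p - 2) / p) (b := 2 / p)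
    (div_nonneg (by linarith) hp0.le) (by positivity) (by field_simp; ring)
  obtain ⟨i2, -⟩ := integral_rpow_mul_rpow_le hSi hXi hS0 hX0 (a := (p - 1) / p) (b := 1 / p)
    (div_nonneg (by linarith) hp0.le) (by positivity) (by field_simp; ring)
  have e1 : ∀ ω, (|S ω| ^ p) ^ ((p - 2) / p) * (|X ω| ^ p) ^ (2 / p)
      = |S ω| ^ (p - 2) * |X ω| ^ (2 : ℝ) := fun ω => by
    rw [← Real.rpow_mul (abs_nonneg _), ← Real.rpow_mul (abs_nonneg _),
      mul_div_cancel₀ _ hp0.ne', mul_div_cancel₀ _ hp0.ne']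
  have e2 : ∀ ω, (|S ω| ^ p) ^ ((p - 1) / p) * (|X ω| ^ p) ^ (1 / p)
      = |S ω| ^ (p - 1) * |X ω| := fun ω => by
    rw [← Real.rpow_mul (abs_nonneg _), ← Real.rpow_mul (abs_nonneg _),
      mul_div_cancel₀ _ hp0.ne', mul_div_cancel₀ _ hp0.ne', Real.rpow_one]
  simp_rw [e1] at i1 l1
  simp_rw [e2] at i2
  set φ : ℝ → ℝ := fun x => |x| ^ (p - 2) * x with hφ
  have hφc : Continuous φ :=
    (continuous_abs.rpow_const fun _ => Or.inr (by linarith)).mul continuous_id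
  have hφSG : AEStronglyMeasurable[G] (fun ω => φ (S ω)) μ :=
    hφc.comp_aestronglyMeasurable hSG
  have hφX : Integrable ((fun ω => φ (S ω)) * X) μ := by
    refine i2.mono ((hφSG.mono hG).mul hX.1) (ae_of_all _ fun ω => ?_)
    simp only [hφ, Pi.mul_apply, norm_mul, Real.norm_eq_abs, abs_abs]
    rw [abs_of_nonneg (Real.rpow_nonneg (abs_nonneg (S ω)) (p - 2)),
      abs_of_nonneg (Real.rpow_nonneg (abs_nonneg (S ω)) (p - 1))]
    refine le_of_eq ?_
    congr 1
    rcases eq_or_ne (S ω) 0 with h | h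
    · rw [h, abs_zero, mul_zero, Real.zero_rpow (by linarith)]
    · have := abs_pos.2 h
      rw [show p - 1 = p - 2 + 1 by ring, Real.rpow_add this, Real.rpow_one]
  -- `φ (S)` is, up to the factor `p`, the derivative of `|S| ^ p`; being `G`-measurable, it can be
  -- pulled out of the conditional expectation of `X`.
  have hzero : ∫ ω, φ (S ω) * X ω ∂μ = 0 := by
    have h1 := condExp_mul_of_aestronglyMeasurable_left hφSG hφX (hX.integrable hp1)
    have h2 : ∫ ω, (μ[(fun ω => φ (S ω)) * X | G]) ω ∂μ = ∫ ω, φ (S ω) * X ω ∂μ :=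
      integral_condExp hG
    rw [← h2]
    refine integral_eq_zero_of_ae ?_
    filter_upwards [h1, hXG] with ω h3 h4
    rw [h3, Pi.mul_apply, h4]
    simp
  have hmain : ∫ ω, |(S + X) ω| ^ p ∂μ ≤ ∫ ω, |S ω| ^ p ∂μ + smoothConst p *
      ((∫ ω, |S ω| ^ p ∂μ) ^ ((p - 2) / p) * (∫ ω, |X ω| ^ p ∂μ) ^ (2 / p)
        + ∫ ω, |X ω| ^ p ∂μ) := by
    calc ∫ ω, |(S + X) ω| ^ p ∂μ
        ≤ ∫ ω, (|S ω| ^ p + p * (φ (S ω) * X ω)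
          + smoothConst p * (|S ω| ^ (p - 2) * |X ω| ^ (2 : ℝ) + |X ω| ^ p)) ∂μ := by
          refine integral_mono hSXi ((hSi.add (hφX.const_mul p)).add
            ((i1.add hXi).const_mul _)) fun ω => ?_
          exact abs_add_rpow_le hp (S ω) (X ω)
      _ = ∫ ω, |S ω| ^ p ∂μ + p * ∫ ω, φ (S ω) * X ω ∂μ
          + smoothConst p * (∫ ω, |S ω| ^ (p - 2) * |X ω| ^ (2 : ℝ) ∂μ + ∫ ω, |X ω| ^ p ∂μ) := by
          have j1 : Integrable (fun ω => p * (φ (S ω) * X ω)) μ := hφX.const_mul p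
          have j2 : Integrable (fun ω => |S ω| ^ p + p * (φ (S ω) * X ω)) μ := hSi.add j1
          have j3 : Integrable (fun ω => smoothConst p *
              (|S ω| ^ (p - 2) * |X ω| ^ (2 : ℝ) + |X ω| ^ p)) μ := (i1.add hXi).const_mul _
          rw [integral_add j2 j3, integral_add hSi j1, integral_const_mul, integral_const_mul,
            integral_add i1 hXi]
      _ ≤ _ := by
          rw [hzero, mul_zero, add_zero]
          gcongr
  rw [(hS.add hX).sq_eLpNorm_eq hp0, hS.sq_eLpNorm_eq hp0, hX.sq_eLpNorm_eq hp0]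
  set A := ∫ ω, |S ω| ^ p ∂μ
  set D := ∫ ω, |X ω| ^ p ∂μ
  have hA : 0 ≤ A := integral_nonneg hS0
  have hD : 0 ≤ D := integral_nonneg hX0
  have hmc : (martConst p : ℝ≥0∞) ^ 2 = ENNReal.ofReal (2 * smoothConst p) := by
    rw [← ENNReal.coe_pow, ← ENNReal.ofReal_coe_nnreal]
    congr 1
    rw [NNReal.coe_pow]
    change √(2 * |smoothConst p|) ^ 2 = _
    rw [Real.sq_sqrt (by positivity), abs_of_nonneg (by linarith)]
  rw [hmc, ← ENNReal.ofReal_mul (by linarith), ← ENNReal.ofReal_add (by positivity) (by positivity)]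
  refine ENNReal.ofReal_le_ofReal ?_
  have hpow : ∀ z : ℝ, 0 ≤ z → (z ^ (2 / p)) ^ (p / 2) = z := fun z hz => by
    rw [← Real.rpow_mul hz]; field_simp; simp
  have h6 := rpow_add_bound (q := p / 2) (s := A ^ (2 / p)) (x := D ^ (2 / p)) (C := smoothConst p)
    (by linarith) (by positivity) (by positivity) hC
  rw [hpow A hA, hpow D hD, ← Real.rpow_mul hA,
    show 2 / p * (p / 2 - 1) = (p - 2) / p by field_simp] at h6
  have h7 := Real.rpow_le_rpow (integral_nonneg fun ω => by positivity) (hmain.trans h6)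
    (by positivity : 0 ≤ 2 / p)
  refine h7.trans (le_of_eq ?_)
  rw [← Real.rpow_mul (by positivity), show p / 2 * (2 / p) = 1 by field_simp, Real.rpow_one]

theorem aestronglyMeasurable_finset_sum_of_sub {Ω ι E : Type*} [NormedAddCommGroup E]
    {G m0 : MeasurableSpace Ω} {μ : Measure Ω} {s : Finset ι} {X : ι → Ω → E}
    (h : ∀ i ∈ s, AEStronglyMeasurable[G] (X i) μ) :
    AEStronglyMeasurable[G] (∑ i ∈ s, X i) μ :=
  Finset.sum_induction _ (fun f => AEStronglyMeasurable[G] f μ) (fun _ _ h1 h2 => h1.add h2)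
    stronglyMeasurable_zero.aestronglyMeasurable h

theorem sum_Icc_eq_sum_range_sub {β : Type*} [AddCommMonoid β] (f : ℤ → β) (T : ℕ) :
    ∑ t ∈ Finset.Icc (1 : ℤ) T, f t = ∑ i ∈ Finset.range T, f (T - i) := by
  refine Finset.sum_nbij' (fun t => (T - t).toNat) (fun i => (T : ℤ) - i) ?_ ?_ ?_ ?_ ?_
  · intro t ht; simp only [Finset.mem_Icc, Finset.mem_range] at *; omega
  · intro t ht; simp only [Finset.mem_Icc, Finset.mem_range] at *; omega
  · intro t ht; simp only [Finset.mem_Icc] at *; omega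
  · intro t ht; simp only [Finset.mem_range] at *; omega
  · intro t ht
    simp only [Finset.mem_Icc] at *
    congr 1
    omega

/-- The one-step inequality has coefficient exactly `1` on the accumulated sum, so the constant does
not grow under iteration. -/
theorem sq_eLpNorm_sum_range_le {Ω : Type*} {m0 : MeasurableSpace Ω} {μ : Measure Ω}
    [IsProbabilityMeasure μ] {p : ℝ} (hp : 2 ≤ p) (G : ℕ → MeasurableSpace Ω)
    (hG : ∀ i, G i ≤ m0) (X : ℕ → Ω → ℝ) (hX : ∀ i, MemLp (X i) (ENNReal.ofReal p) μ)
    (hXG : ∀ i j, i < j → AEStronglyMeasurable[G j] (X i) μ) (h0 : ∀ i, μ[X i | G i] =ᵐ[μ] 0)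
    (n : ℕ) :
    eLpNorm (∑ i ∈ Finset.range n, X i) (ENNReal.ofReal p) μ ^ 2 ≤
      (martConst p : ℝ≥0∞) ^ 2
        * ∑ i ∈ Finset.range n, eLpNorm (X i) (ENNReal.ofReal p) μ ^ 2 := by
  induction n with
  | zero => simp
  | succ n ih =>
    rw [Finset.sum_range_succ, Finset.sum_range_succ, mul_add]
    refine (sq_eLpNorm_add_le hp (hG n) (memLp_finsetSum' _ fun i _ => hX i) (hX n) ?_
      (h0 n)).trans (by gcongr)
    exact aestronglyMeasurable_finset_sum_of_sub fun i hi => hXG i n (Finset.mem_range.1 hi)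

/-- The moment inequality for sums of martingale differences running backwards in time. -/
theorem sq_eLpNorm_sum_backward_le {Ω : Type*} {m0 : MeasurableSpace Ω} {μ : Measure Ω}
    [IsProbabilityMeasure μ] {p : ℝ} (hp : 2 ≤ p) (G : ℤ → MeasurableSpace Ω)
    (hG : ∀ t, G t ≤ m0) (V : ℤ → Ω → ℝ) (hV : ∀ t, MemLp (V t) (ENNReal.ofReal p) μ)
    (hVG : ∀ s t, s < t → AEStronglyMeasurable[G s] (V t) μ) (h0 : ∀ t, μ[V t | G t] =ᵐ[μ] 0)
    (T : ℕ) :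
    eLpNorm (∑ t ∈ Finset.Icc (1 : ℤ) T, V t) (ENNReal.ofReal p) μ ^ 2 ≤
      (martConst p : ℝ≥0∞) ^ 2
        * ∑ t ∈ Finset.Icc (1 : ℤ) T, eLpNorm (V t) (ENNReal.ofReal p) μ ^ 2 := by
  rw [sum_Icc_eq_sum_range_sub, sum_Icc_eq_sum_range_sub]
  exact sq_eLpNorm_sum_range_le hp (fun i => G (T - i)) (fun i => hG _) (fun i => V (T - i))
    (fun i => hV _) (fun i j hij => hVG _ _ (by omega)) (fun i => h0 _) T

/-! ### Conditional expectations given blocks of independent innovations. -/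

theorem setIntegral_inter_of_indep {Ω E : Type*} [NormedAddCommGroup E] [NormedSpace ℝ E]
    [CompleteSpace E] {H G m0 : MeasurableSpace Ω} {μ : Measure Ω} [IsProbabilityMeasure μ]
    (hH : H ≤ m0) (hG : G ≤ m0) (hind : Indep H G μ) {f : Ω → E} (hf : StronglyMeasurable[H] f)
    (hfi : Integrable f μ) {u v : Set Ω} (hu : MeasurableSet[H] u) (hv : MeasurableSet[G] v) :
    ∫ ω in u ∩ v, f ω ∂μ = μ.real v • ∫ ω in u, f ω ∂μ := by
  have h1 := condExp_indep_eq hH hG (hf.indicator hu) hind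
  have h2 := setIntegral_condExp hG (hfi.indicator (hH _ hu)) hv
  rw [setIntegral_congr_ae (hG _ hv) (h1.mono fun x hx _ => hx), setIntegral_const,
    integral_indicator (hH _ hu), setIntegral_indicator (hH _ hu), Set.inter_comm] at h2
  exact h2.symm

theorem isPiSystem_inter_of_measurableSet {Ω : Type*} (G₁ G₂ : MeasurableSpace Ω) :
    IsPiSystem {s : Set Ω | ∃ u v, MeasurableSet[G₁] u ∧ MeasurableSet[G₂] v ∧ s = u ∩ v} := by
  rintro _ ⟨u, v, hu, hv, rfl⟩ _ ⟨u', v', hu', hv', rfl⟩ -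
  exact ⟨u ∩ u', v ∩ v', hu.inter hu', hv.inter hv', Set.inter_inter_inter_comm _ _ _ _⟩

theorem sup_eq_generateFrom_inter {Ω : Type*} (G₁ G₂ : MeasurableSpace Ω) :
    G₁ ⊔ G₂ = MeasurableSpace.generateFrom
      {s : Set Ω | ∃ u v, MeasurableSet[G₁] u ∧ MeasurableSet[G₂] v ∧ s = u ∩ v} := by
  apply le_antisymm
  · refine sup_le (fun s hs => ?_) (fun s hs => ?_)
    · exact MeasurableSpace.measurableSet_generateFrom
        ⟨s, Set.univ, hs, MeasurableSet.univ, (Set.inter_univ s).symm⟩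
    · exact MeasurableSpace.measurableSet_generateFrom
        ⟨Set.univ, s, MeasurableSet.univ, hs, (Set.univ_inter s).symm⟩
  · refine MeasurableSpace.generateFrom_le ?_
    rintro _ ⟨u, v, hu, hv, rfl⟩
    exact MeasurableSet.inter ((le_sup_left : G₁ ≤ G₁ ⊔ G₂) _ hu)
      ((le_sup_right : G₂ ≤ G₁ ⊔ G₂) _ hv)

/-- Enlarging the conditioning by independent information does not change the conditional
expectation. -/
theorem condExp_sup_of_indep {Ω E : Type*} [NormedAddCommGroup E] [NormedSpace ℝ E]
    [CompleteSpace E] {G₁ G₂ H m0 : MeasurableSpace Ω} {μ : Measure Ω} [IsProbabilityMeasure μ]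
    (hH : H ≤ m0) (h₁ : G₁ ≤ H) (h₂ : G₂ ≤ m0) (hind : Indep H G₂ μ) {f : Ω → E}
    (hf : StronglyMeasurable[H] f) (hfi : Integrable f μ) :
    μ[f | G₁ ⊔ G₂] =ᵐ[μ] μ[f | G₁] := by
  have hsup : G₁ ⊔ G₂ ≤ m0 := sup_le (h₁.trans hH) h₂
  have hg : Integrable (μ[f | G₁]) μ := integrable_condExp
  have hgm : StronglyMeasurable[G₁ ⊔ G₂] (μ[f | G₁]) :=
    stronglyMeasurable_condExp.mono le_sup_left
  refine (ae_eq_condExp_of_forall_setIntegral_eq hsup hfi (fun s _ _ => hg.integrableOn) ?_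
    hgm.aestronglyMeasurable).symm
  intro s hs _
  -- It suffices to compare integrals over sets `u ∩ v`, a π-system generating the join, where
  -- independence factors out the measure of `v`.
  induction s, hs using MeasurableSpace.induction_on_inter (sup_eq_generateFrom_inter G₁ G₂)
    (isPiSystem_inter_of_measurableSet G₁ G₂) with
  | empty => simp
  | basic t ht =>
    obtain ⟨u, v, hu, hv, rfl⟩ := ht
    rw [setIntegral_inter_of_indep hH h₂ hind hf hfi (h₁ _ hu) hv,
      setIntegral_inter_of_indep hH h₂ hind (stronglyMeasurable_condExp.mono h₁) hg (h₁ _ hu) hv,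
      setIntegral_condExp (h₁.trans hH) hfi hu]
  | compl t htm ih =>
    have e1 := integral_add_compl (hsup _ htm) hg
    have e2 := integral_add_compl (hsup _ htm) hfi
    rw [integral_condExp (h₁.trans hH)] at e1
    rw [ih (measure_lt_top _ _), ← e2] at e1
    exact add_left_cancel e1
  | iUnion f' hd hm ih =>
    rw [integral_iUnion (fun i => hsup _ (hm i)) hd hg.integrableOn,
      integral_iUnion (fun i => hsup _ (hm i)) hd hfi.integrableOn]
    exact tsum_congr fun i => ih i (measure_lt_top _ _)

/-- The σ-field generated by the coordinates in `A` of the family `Z`. -/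
abbrev sigmaOn {Ω S ι : Type*} [mS : MeasurableSpace S] (Z : ι → Ω → S) (A : Set ι) :
    MeasurableSpace Ω := ⨆ i ∈ A, mS.comap (Z i)

section SigmaOn

variable {Ω S ι : Type*} [mS : MeasurableSpace S] {Z : ι → Ω → S}

theorem sigmaOn_mono {A B : Set ι} (h : A ⊆ B) : sigmaOn Z A ≤ sigmaOn Z B :=
  biSup_mono fun _ hi => h hi

theorem sigmaOn_union (A B : Set ι) : sigmaOn Z (A ∪ B) = sigmaOn Z A ⊔ sigmaOn Z B :=
  iSup_union

theorem sigmaOn_empty : sigmaOn Z (∅ : Set ι) = ⊥ := by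
  simp [sigmaOn]

theorem sigmaOn_le [m0 : MeasurableSpace Ω] (hZ : ∀ i, Measurable (Z i)) (A : Set ι) :
    sigmaOn Z A ≤ m0 :=
  iSup₂_le fun i _ => (hZ i).comap_le

theorem measurable_sigmaOn {A : Set ι} {i : ι} (hi : i ∈ A) : Measurable[sigmaOn Z A] (Z i) :=
  measurable_iff_comap_le.2 (le_iSup₂_of_le i hi le_rfl)

theorem sigmaOn_comp_image {κ : Type*} (f : κ → ι) (A : Set κ) :
    sigmaOn Z (f '' A) = sigmaOn (fun k => Z (f k)) A := by
  simp only [sigmaOn, iSup_image]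

theorem indep_sigmaOn [MeasurableSpace Ω] {μ : Measure Ω} (hZ : ∀ i, Measurable (Z i))
    (hind : iIndepFun Z μ) {A B : Set ι} (hAB : Disjoint A B) :
    Indep (sigmaOn Z A) (sigmaOn Z B) μ :=
  indep_iSup_of_disjoint (fun i => (hZ i).comap_le) hind hAB

/-- The block `A \ B` is independent of everything generated by `B`, so it can be dropped from the
conditioning. -/
theorem condExp_sigmaOn_inter {E : Type*} [NormedAddCommGroup E] [NormedSpace ℝ E]
    [CompleteSpace E] [MeasurableSpace Ω] {μ : Measure Ω} [IsProbabilityMeasure μ]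
    (hZ : ∀ i, Measurable (Z i)) (hind : iIndepFun Z μ) (A B : Set ι) {f : Ω → E}
    (hf : StronglyMeasurable[sigmaOn Z B] f) (hfi : Integrable f μ) :
    μ[f | sigmaOn Z A] =ᵐ[μ] μ[f | sigmaOn Z (A ∩ B)] := by
  have h1 : sigmaOn Z A = sigmaOn Z (A ∩ B) ⊔ sigmaOn Z (A \ B) := by
    rw [← sigmaOn_union, Set.inter_union_sdiff]
  rw [h1]
  exact condExp_sup_of_indep (sigmaOn_le hZ B) (sigmaOn_mono Set.inter_subset_right)
    (sigmaOn_le hZ _) (indep_sigmaOn hZ hind Set.disjoint_sdiff_right) hf hfi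

end SigmaOn

/-! ### Coupling: the dependence measure controls increments of window expectations. -/

theorem measurable_pastSeq {Ω S : Type*} [MeasurableSpace S] {G : MeasurableSpace Ω} {e : ℤ → Ω → S} {t : ℤ}
    (h : ∀ s ≤ t, Measurable[G] (e s)) : Measurable[G] (pastSeq e t) :=
  measurable_pi_iff.2 fun j => h _ (by omega)

theorem measurable_switchedSeq {Ω S : Type*} [MeasurableSpace S] {G : MeasurableSpace Ω} {e eDag : ℤ → Ω → S} {t : ℤ} {q : ℕ}
    (h : ∀ s, s ≠ t - q → Measurable[G] (e s)) (hq : Measurable[G] (eDag (t - q))) :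
    Measurable[G] (switchedSeq e eDag t q) := by
  refine measurable_pi_iff.2 fun j => ?_
  rcases eq_or_ne j q with rfl | hj
  · simpa [switchedSeq] using hq
  · have : (fun ω => switchedSeq e eDag t q ω j) = e (t - j) := by
      funext ω
      simp [switchedSeq, hj, pastSeq]
    rw [this]
    exact h _ (by omega)

section Coupling

variable {Ω S : Type*} [MeasurableSpace Ω] [MeasurableSpace S] {μ : Measure Ω}
  {e eDag : ℤ → Ω → S}

/-- Both sequences are injective reindexings of one independent family with matching marginals, so
both have the same infinite product law. -/
theorem map_switchedSeq_eq [IsProbabilityMeasure μ] (h : IsInnovationPair μ e eDag)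
    (t : ℤ) (q : ℕ) : μ.map (switchedSeq e eDag t q) = μ.map (pastSeq e t) := by
  set σ : ℕ → ℤ ⊕ ℤ := fun j => if j = q then Sum.inr (t - j) else Sum.inl (t - j) with hσ
  have hσi : Function.Injective σ := by
    intro i j hij
    simp only [hσ] at hij
    split_ifs at hij <;> simp at hij <;> omega
  have hσ' : Function.Injective (fun j : ℕ => (Sum.inl (t - j) : ℤ ⊕ ℤ)) := by
    intro i j hij
    simp at hij
    omega
  have hZ : ∀ i, Measurable (Sum.elim e eDag i) := by
    rintro (i | i)
    · exact h.measurable_e i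
    · exact h.measurable_eDag i
  have i1 := (h.indep.precomp hσi).map_fun_eq_infinitePi_map (fun i => hZ _)
  have i2 := (h.indep.precomp hσ').map_fun_eq_infinitePi_map (fun i => hZ _)
  have e1 : (fun ω i => Sum.elim e eDag (σ i) ω) = switchedSeq e eDag t q := by
    funext ω j
    rcases eq_or_ne j q with rfl | hj
    · simp [switchedSeq, hσ]
    · simp [switchedSeq, hσ, hj, pastSeq]
  have e2 : (fun ω (i : ℕ) => Sum.elim e eDag (Sum.inl (t - i)) ω) = pastSeq e t := by
    funext ω j
    simp [pastSeq]
  rw [e1] at i1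
  rw [e2] at i2
  rw [i1, i2]
  congr 1
  funext j
  rcases eq_or_ne j q with rfl | hj
  · simpa [hσ] using (h.identDistrib (t - j)).map_eq
  · simp [hσ, hj]

variable {d : ℕ} {g : ℤ → (ℕ → S) → EuclideanSpace ℝ (Fin d)}

theorem identDistrib_procSwitched [IsProbabilityMeasure μ] (h : IsInnovationPair μ e eDag)
    {t : ℤ} (hg : Measurable (g t)) (q : ℕ) :
    IdentDistrib (procSwitched e eDag g q t) (proc e g t) μ μ := by
  have h1 : IdentDistrib (switchedSeq e eDag t q) (pastSeq e t) μ μ :=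
    ⟨(measurable_switchedSeq (fun s _ => h.measurable_e s) (h.measurable_eDag _)).aemeasurable,
      (measurable_pastSeq fun s _ => h.measurable_e s).aemeasurable, map_switchedSeq_eq h t q⟩
  exact h1.comp hg

/-- The window is made of positions `0, …, q - 1` of the past, which the switch at position `q`
leaves alone. The event is thus the same function of either sequence, and the two laws agree. -/
theorem setIntegral_procSwitched_eq [IsProbabilityMeasure μ] (h : IsInnovationPair μ e eDag)
    {t : ℤ} (hg : Measurable (g t)) (q : ℕ) {s : Set Ω}
    (hs : MeasurableSet[sigmaOn e (Set.Ioc (t - q) t)] s) :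
    ∫ ω in s, procSwitched e eDag g q t ω ∂μ = ∫ ω in s, proc e g t ω ∂μ := by
  set r : (ℕ → S) → (Fin q → S) := fun x j => x j with hr
  have hrm : Measurable r := measurable_pi_iff.2 fun j => measurable_pi_apply _
  have hle : sigmaOn e (Set.Ioc (t - q) t) ≤
      MeasurableSpace.comap (fun ω => r (pastSeq e t ω)) inferInstance := by
    refine iSup₂_le fun i hi => ?_
    rw [← measurable_iff_comap_le]
    have hi1 := hi.1
    have hi2 := hi.2
    have hj : (t - i).toNat < q := by omega
    have : e i = (fun x : Fin q → S => x ⟨(t - i).toNat, hj⟩) ∘ (fun ω => r (pastSeq e t ω)) := by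
      funext ω
      simp only [Function.comp, hr, pastSeq]
      congr 1
      omega
    rw [this]
    exact (measurable_pi_apply _).comp (comap_measurable _)
  obtain ⟨s', hs', rfl⟩ := hle s hs
  have hpm : Measurable (pastSeq e t) := measurable_pastSeq fun s _ => h.measurable_e s
  have hsm : Measurable (switchedSeq e eDag t q) :=
    measurable_switchedSeq (fun s _ => h.measurable_e s) (h.measurable_eDag _)
  have e1 : (fun ω => r (pastSeq e t ω)) ⁻¹' s' = pastSeq e t ⁻¹' (r ⁻¹' s') := rfl
  have e2 : (fun ω => r (pastSeq e t ω)) ⁻¹' s' = switchedSeq e eDag t q ⁻¹' (r ⁻¹' s') := by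
    have : (fun ω => r (pastSeq e t ω)) = fun ω => r (switchedSeq e eDag t q ω) := by
      funext ω j
      have := j.2
      simp [hr, switchedSeq, this.ne]
    rw [this]
    rfl
  have hgm : StronglyMeasurable (g t) := hg.stronglyMeasurable
  calc ∫ ω in (fun ω => r (pastSeq e t ω)) ⁻¹' s', procSwitched e eDag g q t ω ∂μ
      = ∫ x in r ⁻¹' s', g t x ∂(μ.map (switchedSeq e eDag t q)) := by
        rw [setIntegral_map (hrm hs') hgm.aestronglyMeasurable hsm.aemeasurable, e2]
        rfl
    _ = ∫ x in r ⁻¹' s', g t x ∂(μ.map (pastSeq e t)) := by rw [map_switchedSeq_eq h t q]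
    _ = _ := by
        rw [setIntegral_map (hrm hs') hgm.aestronglyMeasurable hpm.aemeasurable, e1]
        rfl

/-- The switched value does not involve `e_{t-q}`, so that innovation can be removed from the
conditioning; on the remaining window the switch is invisible. -/
theorem condExp_procSwitched [IsProbabilityMeasure μ] (h : IsInnovationPair μ e eDag)
    {t : ℤ} (hg : Measurable (g t)) (hi : Integrable (proc e g t) μ) (q : ℕ) :
    μ[procSwitched e eDag g q t | sigmaOn e (Set.Ioc (t - (q + 1 : ℕ)) t)]
      =ᵐ[μ] μ[proc e g t | sigmaOn e (Set.Ioc (t - q) t)] := by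
  have hZ : ∀ i, Measurable (Sum.elim e eDag i) := by
    rintro (i | i)
    · exact h.measurable_e i
    · exact h.measurable_eDag i
  have hYi : Integrable (procSwitched e eDag g q t) μ :=
    (identDistrib_procSwitched h hg q).integrable_iff.2 hi
  set B : Set (ℤ ⊕ ℤ) := Sum.inl '' {s | s ≠ t - q} ∪ {Sum.inr (t - q)} with hB
  have hY : StronglyMeasurable[sigmaOn (Sum.elim e eDag) B] (procSwitched e eDag g q t) := by
    refine Measurable.stronglyMeasurable (hg.comp (measurable_switchedSeq ?_ ?_))
    · intro s hs
      exact measurable_sigmaOn (Z := Sum.elim e eDag) (i := Sum.inl s)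
        (Or.inl ⟨s, hs, rfl⟩)
    · exact measurable_sigmaOn (Z := Sum.elim e eDag) (i := Sum.inr (t - q)) (Or.inr rfl)
  have hF : ∀ A : Set ℤ, sigmaOn e A = sigmaOn (Sum.elim e eDag) (Sum.inl '' A) := fun A => by
    rw [sigmaOn_comp_image]
    rfl
  have hAB : Sum.inl '' Set.Ioc (t - (q + 1 : ℕ)) t ∩ B = Sum.inl '' Set.Ioc (t - q) t := by
    ext (x | x)
    · simp [hB]
      omega
    · simp [hB]
  have h1 := condExp_sigmaOn_inter hZ h.indep (Sum.inl '' Set.Ioc (t - (q + 1 : ℕ)) t) B hY hYi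
  rw [hAB, ← hF, ← hF] at h1
  refine h1.trans ?_
  have hle := sigmaOn_le h.measurable_e (Set.Ioc (t - q) t)
  refine ae_eq_condExp_of_forall_setIntegral_eq hle hi
    (fun s _ _ => integrable_condExp.integrableOn) (fun s hs _ => ?_)
    stronglyMeasurable_condExp.aestronglyMeasurable
  rw [setIntegral_condExp hle hYi hs]
  exact setIntegral_procSwitched_eq h hg q hs

theorem eLpNorm_inner_le_of_unit {E : Type*} [NormedAddCommGroup E] [InnerProductSpace ℝ E]
    {p c : ℝ≥0∞} {X : Ω → E}
    (h : ∀ a : E, ‖a‖ = 1 → eLpNorm (fun ω => inner ℝ a (X ω)) p μ ≤ c) (a : E) :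
    eLpNorm (fun ω => inner ℝ a (X ω)) p μ ≤ ‖a‖ₑ * c := by
  rcases eq_or_ne a 0 with rfl | ha
  · simp
  · have ha' : ‖a‖ ≠ 0 := norm_ne_zero_iff.2 ha
    have h1 := h (‖a‖⁻¹ • a) (by rw [norm_smul, norm_inv, norm_norm, inv_mul_cancel₀ ha'])
    have e1 : (fun ω => inner ℝ a (X ω)) = ‖a‖ • fun ω => inner ℝ (‖a‖⁻¹ • a) (X ω) := by
      funext ω
      simp only [Pi.smul_apply, smul_eq_mul, inner_smul_left, RCLike.conj_to_real]
      field_simp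
    rw [e1, eLpNorm_const_smul, enorm_norm]
    gcongr

/-- The increment is the conditional expectation of `ε_t - ε_t(q)` given the larger window, and
conditional expectation contracts `L^M`. Later arguments use `depDelta` only through this bound and
its tail sums. -/
theorem eLpNorm_inner_condExp_sub_le [IsProbabilityMeasure μ] (h : IsInnovationPair μ e eDag)
    {M : ℝ} (hM : 1 ≤ M) {t : ℤ} (hg : Measurable (g t)) (hi : Integrable (proc e g t) μ) (q : ℕ)
    (a : EuclideanSpace ℝ (Fin d)) :
    eLpNorm (fun ω => inner ℝ a (μ[proc e g t | sigmaOn e (Set.Ioc (t - (q + 1 : ℕ)) t)] ω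
      - μ[proc e g t | sigmaOn e (Set.Ioc (t - q) t)] ω)) (ENNReal.ofReal M) μ
      ≤ ‖a‖ₑ * depDelta μ M e eDag g q := by
  have hM1 : (1 : ℝ≥0∞) ≤ ENNReal.ofReal M := by
    rw [← ENNReal.ofReal_one]; exact ENNReal.ofReal_le_ofReal hM
  refine eLpNorm_inner_le_of_unit (fun a ha => ?_) a
  have hYi : Integrable (procSwitched e eDag g q t) μ :=
    (identDistrib_procSwitched h hg q).integrable_iff.2 hi
  have h1 := condExp_sub hi hYi (sigmaOn e (Set.Ioc (t - (q + 1 : ℕ)) t))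
  have h2 := (innerSL ℝ a).comp_condExp_comm (m := sigmaOn e (Set.Ioc (t - (q + 1 : ℕ)) t))
    (hi.sub hYi)
  have h3 : (fun ω => inner ℝ a (μ[proc e g t | sigmaOn e (Set.Ioc (t - (q + 1 : ℕ)) t)] ω
      - μ[proc e g t | sigmaOn e (Set.Ioc (t - q) t)] ω))
      =ᵐ[μ] μ[innerSL ℝ a ∘ (proc e g t - procSwitched e eDag g q t) |
        sigmaOn e (Set.Ioc (t - (q + 1 : ℕ)) t)] := by
    filter_upwards [h1, h2, condExp_procSwitched h hg hi q] with ω k1 k2 k3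
    rw [← k2, Function.comp_apply, k1, Pi.sub_apply, k3, innerSL_apply_apply]
  rw [eLpNorm_congr_ae h3]
  refine (eLpNorm_condExp_le_eLpNorm _ hM1).trans ?_
  exact le_iSup₂_of_le t a (le_iSup_of_le ha le_rfl)

end Coupling

/-! ### From directional moments to norms and inner products. -/

theorem ENNReal.le_mul_sqrt_of_sq_le_sum {ι : Type*} {s : Finset ι} {x C k : ℝ≥0∞} {y : ι → ℝ≥0∞}
    {r : ι → ℝ} (h : x ^ 2 ≤ C ^ 2 * ∑ i ∈ s, y i ^ 2)
    (hy : ∀ i ∈ s, y i ≤ ENNReal.ofReal |r i| * k) :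
    x ≤ C * (k * ENNReal.ofReal √(∑ i ∈ s, r i ^ 2)) := by
  have h0 : 0 ≤ ∑ i ∈ s, r i ^ 2 := Finset.sum_nonneg fun i _ => sq_nonneg _
  rw [← ENNReal.pow_le_pow_left_iff (two_ne_zero)]
  refine h.trans ?_
  rw [mul_pow, mul_pow, ← ENNReal.ofReal_pow (Real.sqrt_nonneg _), Real.sq_sqrt h0,
    ENNReal.ofReal_sum_of_nonneg fun i _ => sq_nonneg _]
  gcongr
  rw [Finset.mul_sum]
  refine Finset.sum_le_sum fun i hi => ?_
  calc y i ^ 2 ≤ (ENNReal.ofReal |r i| * k) ^ 2 := by gcongr; exact hy i hi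
    _ = k ^ 2 * ENNReal.ofReal (r i ^ 2) := by
      rw [mul_pow, mul_comm, ← ENNReal.ofReal_pow (abs_nonneg _), sq_abs]

section Weak

variable {Ω : Type*} {m0 : MeasurableSpace Ω} {μ : Measure Ω} {d : ℕ}

/-- The triangle inequality in `L^{M/2}`, applied to the `d` squared coordinates, costs a factor `d`
for the square, hence `√d` for the norm. -/
theorem eLpNorm_le_sqrt_mul_of_inner_le {M : ℝ} (hM : 2 ≤ M) {c : ℝ≥0∞}
    {X : Ω → EuclideanSpace ℝ (Fin d)} (hX : AEStronglyMeasurable X μ)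
    (h : ∀ a : EuclideanSpace ℝ (Fin d),
      eLpNorm (fun ω => inner ℝ a (X ω)) (ENNReal.ofReal M) μ ≤ ‖a‖ₑ * c) :
    eLpNorm X (ENNReal.ofReal M) μ ≤ ENNReal.ofReal √d * c := by
  have hcoord : ∀ i, eLpNorm (fun ω => X ω i) (ENNReal.ofReal M) μ ≤ c := fun i => by
    have h1 := h (EuclideanSpace.single i 1)
    simpa [EuclideanSpace.inner_single_left, enorm_eq_nnnorm] using h1
  have hmul : ENNReal.ofReal (M / 2) * ENNReal.ofReal 2 = ENNReal.ofReal M := by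
    rw [← ENNReal.ofReal_mul (by linarith)]
    congr 1
    ring
  have hp : (1 : ℝ≥0∞) ≤ ENNReal.ofReal (M / 2) := by
    rw [← ENNReal.ofReal_one]; exact ENNReal.ofReal_le_ofReal (by linarith)
  have e1 := eLpNorm_norm_rpow (p := ENNReal.ofReal (M / 2)) (μ := μ) X (q := 2) (by norm_num)
  rw [hmul] at e1
  have e2 : (fun ω => ‖X ω‖ ^ (2 : ℝ)) = ∑ i, fun ω => ‖X ω i‖ ^ (2 : ℝ) := by
    funext ω
    rw [Finset.sum_apply, Real.rpow_two, EuclideanSpace.norm_sq_eq]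
    simp
  have hmeas : ∀ i, AEStronglyMeasurable (fun ω => X ω i) μ := fun i =>
    (EuclideanSpace.proj (𝕜 := ℝ) i).continuous.comp_aestronglyMeasurable hX
  have h2 : eLpNorm X (ENNReal.ofReal M) μ ^ (2 : ℝ) ≤ d * c ^ (2 : ℝ) := by
    rw [← e1, e2]
    refine (eLpNorm_sum_le (fun i _ => ?_) hp).trans ?_
    · exact ((hmeas i).norm.aemeasurable.pow_const 2).aestronglyMeasurable
    · calc ∑ i, eLpNorm (fun ω => ‖X ω i‖ ^ (2 : ℝ)) (ENNReal.ofReal (M / 2)) μ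
          ≤ ∑ i : Fin d, c ^ (2 : ℝ) := by
            refine Finset.sum_le_sum fun i _ => ?_
            rw [eLpNorm_norm_rpow (fun ω => X ω i) (by norm_num), hmul]
            exact ENNReal.rpow_le_rpow (hcoord i) (by norm_num)
        _ = d * c ^ (2 : ℝ) := by simp
  rw [← ENNReal.pow_le_pow_left_iff (two_ne_zero), mul_pow,
    ← ENNReal.ofReal_pow (Real.sqrt_nonneg _), Real.sq_sqrt (Nat.cast_nonneg d),
    ENNReal.ofReal_natCast]
  simpa [ENNReal.rpow_two] using h2

/-- For fixed `Y = y` only the direction `y` of `X` matters; Fubini then integrates `‖y‖ ^ p`. No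
dimension factor appears. -/
theorem eLpNorm_inner_le_of_indepFun [IsProbabilityMeasure μ] {p : ℝ} (hp : 0 < p) {c : ℝ≥0∞}
    {X Y : Ω → EuclideanSpace ℝ (Fin d)} (hX : AEMeasurable X μ) (hY : AEMeasurable Y μ)
    (hind : IndepFun Y X μ)
    (h : ∀ a : EuclideanSpace ℝ (Fin d),
      eLpNorm (fun ω => inner ℝ a (X ω)) (ENNReal.ofReal p) μ ≤ ‖a‖ₑ * c) :
    eLpNorm (fun ω => inner ℝ (X ω) (Y ω)) (ENNReal.ofReal p) μ
      ≤ c * eLpNorm Y (ENNReal.ofReal p) μ := by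
  have hp0 : ENNReal.ofReal p ≠ 0 := by simpa using hp
  have hpow : ∀ {F : Type} [NormedAddCommGroup F] (f : Ω → F),
      eLpNorm f (ENNReal.ofReal p) μ ^ p = ∫⁻ ω, ‖f ω‖ₑ ^ p ∂μ := by
    intro F _ f
    rw [eLpNorm_eq_lintegral_rpow_enorm_toReal hp0 ENNReal.ofReal_ne_top,
      ENNReal.toReal_ofReal hp.le, ← ENNReal.rpow_mul, one_div, inv_mul_cancel₀ hp.ne',
      ENNReal.rpow_one]
  rw [← ENNReal.rpow_le_rpow_iff hp, ENNReal.mul_rpow_of_nonneg _ _ hp.le, hpow, hpow]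
  have hmap := (indepFun_iff_map_prod_eq_prod_map_map hY hX).1 hind
  set f : EuclideanSpace ℝ (Fin d) × EuclideanSpace ℝ (Fin d) → ℝ≥0∞ :=
    fun z => ‖(inner ℝ z.1 z.2 : ℝ)‖ₑ ^ p with hf
  have hfm : Measurable f := by
    have : Continuous fun z : EuclideanSpace ℝ (Fin d) × EuclideanSpace ℝ (Fin d) =>
      (inner ℝ z.1 z.2 : ℝ) := by fun_prop
    exact this.measurable.enorm.pow_const p
  have := Measure.isProbabilityMeasure_map hX
  calc ∫⁻ ω, ‖(inner ℝ (X ω) (Y ω) : ℝ)‖ₑ ^ p ∂μ = ∫⁻ ω, f (Y ω, X ω) ∂μ := by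
        simp only [hf, real_inner_comm]
    _ = ∫⁻ z, f z ∂((μ.map Y).prod (μ.map X)) := by
        rw [← hmap, lintegral_map' hfm.aemeasurable (hY.prodMk hX)]
    _ = ∫⁻ y, ∫⁻ x, f (y, x) ∂(μ.map X) ∂(μ.map Y) := lintegral_prod _ hfm.aemeasurable
    _ ≤ ∫⁻ y, c ^ p * ‖y‖ₑ ^ p ∂(μ.map Y) := by
        refine lintegral_mono fun y => ?_
        have hfy : Measurable fun x => f (y, x) := hfm.comp measurable_prodMk_left
        rw [lintegral_map' hfy.aemeasurable hX, ← hpow (fun ω => (inner ℝ y (X ω) : ℝ)),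
          ← ENNReal.mul_rpow_of_nonneg _ _ hp.le, mul_comm]
        exact ENNReal.rpow_le_rpow (h y) hp.le
    _ = c ^ p * ∫⁻ ω, ‖Y ω‖ₑ ^ p ∂μ := by
        rw [lintegral_const_mul _ (measurable_enorm.pow_const p),
          lintegral_map' (measurable_enorm.pow_const p).aemeasurable hY]

theorem holderTriple_ofReal_half {M : ℝ} (hM : 0 < M) :
    ENNReal.HolderTriple (ENNReal.ofReal M) (ENNReal.ofReal M) (ENNReal.ofReal (M / 2)) := by
  refine ⟨?_⟩
  rw [← ENNReal.ofReal_inv_of_pos hM, ← ENNReal.ofReal_inv_of_pos (by linarith),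
    ← ENNReal.ofReal_add (by positivity) (by positivity)]
  congr 1
  field_simp
  norm_num

theorem eLpNorm_inner_le {M : ℝ} (hM : 0 < M) {X Y : Ω → EuclideanSpace ℝ (Fin d)}
    (hX : AEStronglyMeasurable X μ) (hY : AEStronglyMeasurable Y μ) :
    eLpNorm (fun ω => inner ℝ (X ω) (Y ω)) (ENNReal.ofReal (M / 2)) μ
      ≤ eLpNorm X (ENNReal.ofReal M) μ * eLpNorm Y (ENNReal.ofReal M) μ := by
  have := holderTriple_ofReal_half hM
  simpa using eLpNorm_le_eLpNorm_mul_eLpNorm_of_nnnorm (p := ENNReal.ofReal M)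
    (q := ENNReal.ofReal M) (r := ENNReal.ofReal (M / 2)) hX hY (fun x y => (inner ℝ x y : ℝ)) 1
    (ae_of_all _ fun ω => by
      rw [one_mul]
      exact nnnorm_inner_le_nnnorm (𝕜 := ℝ) (X ω) (Y ω))

theorem MeasureTheory.MemLp.inner_half {M : ℝ} (hM : 0 < M) {X Y : Ω → EuclideanSpace ℝ (Fin d)}
    (hX : MemLp X (ENNReal.ofReal M) μ) (hY : MemLp Y (ENNReal.ofReal M) μ) :
    MemLp (fun ω => (inner ℝ (X ω) (Y ω) : ℝ)) (ENNReal.ofReal (M / 2)) μ :=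
  ⟨hX.1.inner hY.1, (eLpNorm_inner_le hM hX.1 hY.1).trans_lt (ENNReal.mul_lt_top hX.2 hY.2)⟩

/-- Fatou's lemma; it carries bounds from finite windows to the whole past. -/
theorem eLpNorm_le_of_ae_tendsto {E : Type*} [NormedAddCommGroup E] {p c : ℝ≥0∞}
    {f : ℕ → Ω → E} {g : Ω → E} (hf : ∀ n, AEStronglyMeasurable (f n) μ)
    (hlim : ∀ᵐ ω ∂μ, Tendsto (fun n => f n ω) atTop (nhds (g ω)))
    (hb : ∀ᶠ n in atTop, eLpNorm (f n) p μ ≤ c) : eLpNorm g p μ ≤ c :=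
  (Lp.eLpNorm_lim_le_liminf_eLpNorm hf g hlim).trans
    (liminf_le_of_le (by isBoundedDefault) fun _ hb' =>
      let ⟨_, h1, h2⟩ := (hb'.and hb).exists
      h1.trans h2)

end Weak

/-! ### Causal processes: window expectations and linear sums. -/

/-- The real inner product as a continuous bilinear map. -/
def innerBilin (E : Type*) [NormedAddCommGroup E] [InnerProductSpace ℝ E] : E →L[ℝ] E →L[ℝ] ℝ :=
  (isBoundedBilinearMap_inner (𝕜 := ℝ) (E := E)).toContinuousLinearMap

theorem one_le_ofReal_of_le {M : ℝ} (hM : 1 ≤ M) : (1 : ℝ≥0∞) ≤ ENNReal.ofReal M := by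
  rw [← ENNReal.ofReal_one]; exact ENNReal.ofReal_le_ofReal hM

theorem condExp_inner_of_right {Ω : Type*} {G m0 : MeasurableSpace Ω} {μ : Measure Ω}
    [IsProbabilityMeasure μ] {d : ℕ} {M : ℝ} (hM : 2 ≤ M) {X Y : Ω → EuclideanSpace ℝ (Fin d)}
    (hX : MemLp X (ENNReal.ofReal M) μ) (hY : MemLp Y (ENNReal.ofReal M) μ)
    (hYG : AEStronglyMeasurable[G] Y μ) :
    μ[fun ω => (inner ℝ (X ω) (Y ω) : ℝ) | G] =ᵐ[μ] fun ω => inner ℝ (μ[X | G] ω) (Y ω) :=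
  condExp_bilin_of_aestronglyMeasurable_right (innerBilin _) hYG
    ((hX.inner_half (by linarith) hY).integrable (one_le_ofReal_of_le (by linarith)))
    (hX.integrable (one_le_ofReal_of_le (by linarith)))

/-- A process of mean zero that is adapted to the past of independent innovations, with moments of
order `M`, whose conditional expectations given windows of innovations have increments bounded
by `δ`. -/
structure CausalProcess {Ω S : Type*} [MeasurableSpace Ω] [MeasurableSpace S] {d : ℕ}
    (μ : Measure Ω) (M : ℝ) (e : ℤ → Ω → S) (X : ℤ → Ω → EuclideanSpace ℝ (Fin d))
    (δ : ℕ → ℝ≥0∞) : Prop where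
  measurable_e : ∀ t, Measurable (e t)
  indep : iIndepFun e μ
  four_lt : 4 < M
  adapted : ∀ t, StronglyMeasurable[sigmaOn e (Set.Iic t)] (X t)
  memLp : ∀ t, MemLp (X t) (ENNReal.ofReal M) μ
  mean_zero : ∀ t, ∫ ω, X t ω ∂μ = 0
  incr_le : ∀ (q : ℕ) (t : ℤ) (a : EuclideanSpace ℝ (Fin d)),
    eLpNorm (fun ω => inner ℝ a (μ[X t | sigmaOn e (Set.Ioc (t - (q + 1 : ℕ)) t)] ω
      - μ[X t | sigmaOn e (Set.Ioc (t - q) t)] ω)) (ENNReal.ofReal M) μ ≤ ‖a‖ₑ * δ q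

/-- The conditional expectation of `X t` given the last `n` innovations. -/
def winExp {Ω S : Type*} [MeasurableSpace Ω] [MeasurableSpace S] {d : ℕ}
    (μ : Measure Ω) (e : ℤ → Ω → S) (X : ℤ → Ω → EuclideanSpace ℝ (Fin d)) (n : ℕ) (t : ℤ) :
    Ω → EuclideanSpace ℝ (Fin d) :=
  μ[X t | sigmaOn e (Set.Ioc (t - n) t)]

/-- The difference of the conditional expectations given the last `m` and `n` innovations. -/
def winIncr {Ω S : Type*} [MeasurableSpace Ω] [MeasurableSpace S] {d : ℕ}
    (μ : Measure Ω) (e : ℤ → Ω → S) (X : ℤ → Ω → EuclideanSpace ℝ (Fin d)) (n m : ℕ) (t : ℤ) :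
    Ω → EuclideanSpace ℝ (Fin d) :=
  winExp μ e X m t - winExp μ e X n t

namespace CausalProcess

variable {Ω S : Type*} {m0 : MeasurableSpace Ω} [MeasurableSpace S] {μ : Measure Ω}
  {M : ℝ} {e : ℤ → Ω → S} {d : ℕ}
  {X : ℤ → Ω → EuclideanSpace ℝ (Fin d)} {δ : ℕ → ℝ≥0∞}

theorem one_le (h : CausalProcess μ M e X δ) : (1 : ℝ≥0∞) ≤ ENNReal.ofReal M :=
  one_le_ofReal_of_le (by linarith [h.four_lt])

theorem one_le_half (h : CausalProcess μ M e X δ) : (1 : ℝ≥0∞) ≤ ENNReal.ofReal (M / 2) :=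
  one_le_ofReal_of_le (by linarith [h.four_lt])

theorem sigmaOn_le (h : CausalProcess μ M e X δ) (A : Set ℤ) : sigmaOn e A ≤ m0 :=
  _root_.sigmaOn_le h.measurable_e A

theorem stronglyMeasurable_winExp (n : ℕ) (t : ℤ) :
    StronglyMeasurable[sigmaOn e (Set.Ioc (t - n) t)] (winExp μ e X n t) :=
  stronglyMeasurable_condExp

theorem incr_le' (h : CausalProcess μ M e X δ) (q : ℕ) (t : ℤ) (a : EuclideanSpace ℝ (Fin d)) :
    eLpNorm (fun ω => inner ℝ a (winIncr μ e X q (q + 1) t ω)) (ENNReal.ofReal M) μ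
      ≤ ‖a‖ₑ * δ q :=
  h.incr_le q t a

theorem winIncr_eq_sum {n m : ℕ} (hnm : n ≤ m) (t : ℤ) :
    winIncr μ e X n m t = ∑ q ∈ Finset.Ico n m, winIncr μ e X q (q + 1) t := by
  simp only [winIncr]
  exact (Finset.sum_Ico_sub (fun k => winExp μ e X k t) hnm).symm

theorem memLp_winExp (h : CausalProcess μ M e X δ) (n : ℕ) (t : ℤ) :
    MemLp (winExp μ e X n t) (ENNReal.ofReal M) μ :=
  (h.memLp t).condExp h.one_le

theorem stronglyMeasurable_winIncr {n m : ℕ} (hnm : n ≤ m) (t : ℤ) :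
    StronglyMeasurable[sigmaOn e (Set.Ioc (t - m) t)] (winIncr μ e X n m t) :=
  (stronglyMeasurable_winExp m t).sub ((stronglyMeasurable_winExp n t).mono
    (sigmaOn_mono (Set.Ioc_subset_Ioc_left (by omega))))

theorem memLp_winIncr (h : CausalProcess μ M e X δ) (n m : ℕ) (t : ℤ) :
    MemLp (winIncr μ e X n m t) (ENNReal.ofReal M) μ :=
  (h.memLp_winExp m t).sub (h.memLp_winExp n t)

theorem aestronglyMeasurable_sum_winIncr (h : CausalProcess μ M e X δ) (c : ℤ → ℝ) (T n m : ℕ) :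
    AEStronglyMeasurable
      (fun ω => ∑ t ∈ Finset.Icc (1 : ℤ) T, c t • winIncr μ e X n m t ω) μ :=
  Finset.aestronglyMeasurable_fun_sum _ fun t _ =>
    (h.memLp_winIncr n m t).1.const_smul (c t)

theorem eLpNorm_incr_le (h : CausalProcess μ M e X δ) (q : ℕ) (t : ℤ) :
    eLpNorm (winIncr μ e X q (q + 1) t) (ENNReal.ofReal M) μ ≤ ENNReal.ofReal √d * δ q :=
  eLpNorm_le_sqrt_mul_of_inner_le (by linarith [h.four_lt]) (h.memLp_winIncr _ _ t).1
    (h.incr_le' q t)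

variable [IsProbabilityMeasure μ]

theorem integrable (h : CausalProcess μ M e X δ) (t : ℤ) : Integrable (X t) μ :=
  (h.memLp t).integrable h.one_le

theorem winExp_zero (h : CausalProcess μ M e X δ) (t : ℤ) : winExp μ e X 0 t = 0 := by
  have : Set.Ioc (t - (0 : ℕ)) t = ∅ := by simp
  rw [winExp, this, sigmaOn_empty, condExp_bot, h.mean_zero]
  rfl

theorem winIncr_zero (h : CausalProcess μ M e X δ) (n : ℕ) (t : ℤ) :
    winIncr μ e X 0 n t = winExp μ e X n t := by
  rw [winIncr, h.winExp_zero, sub_zero]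

theorem condExp_winExp (h : CausalProcess μ M e X δ) (A : Set ℤ) (n : ℕ) (t : ℤ) :
    μ[winExp μ e X n t | sigmaOn e A] =ᵐ[μ] μ[X t | sigmaOn e (A ∩ Set.Ioc (t - n) t)] :=
  (condExp_sigmaOn_inter h.measurable_e h.indep A (Set.Ioc (t - n) t)
    (stronglyMeasurable_winExp n t) integrable_condExp).trans
    (condExp_condExp_of_le (sigmaOn_mono Set.inter_subset_right) (h.sigmaOn_le _))

theorem condExp_eq (h : CausalProcess μ M e X δ) (A : Set ℤ) (t : ℤ) :
    μ[X t | sigmaOn e A] =ᵐ[μ] μ[X t | sigmaOn e (A ∩ Set.Iic t)] :=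
  condExp_sigmaOn_inter h.measurable_e h.indep A (Set.Iic t) (h.adapted t) (h.integrable t)

/-- Once only innovations after `t - n` are known, both window expectations reduce to the shorter
one. The conditioning includes innovations after `t`, which is what allows later factors to be
multiplied in. -/
theorem condExp_winIncr_eq_zero (h : CausalProcess μ M e X δ) {n m : ℕ} (hnm : n ≤ m) (t : ℤ) :
    μ[winIncr μ e X n m t | sigmaOn e (Set.Ioi (t - n))] =ᵐ[μ] 0 := by
  have h1 := condExp_sub (m := sigmaOn e (Set.Ioi (t - n)))
    ((h.memLp_winExp m t).integrable h.one_le) ((h.memLp_winExp n t).integrable h.one_le)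
  have h2 := h.condExp_winExp (Set.Ioi (t - n)) n t
  have h3 := h.condExp_winExp (Set.Ioi (t - n)) m t
  have e2 : Set.Ioi (t - (n : ℤ)) ∩ Set.Ioc (t - n) t = Set.Ioc (t - n) t := by
    ext x; simp only [Set.mem_inter_iff, Set.mem_Ioi, Set.mem_Ioc]; omega
  have e3 : Set.Ioi (t - (n : ℤ)) ∩ Set.Ioc (t - m) t = Set.Ioc (t - n) t := by
    ext x; simp only [Set.mem_inter_iff, Set.mem_Ioi, Set.mem_Ioc]; omega
  rw [e2] at h2
  rw [e3] at h3
  filter_upwards [h1, h2, h3] with ω k1 k2 k3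
  rw [winIncr, k1, Pi.sub_apply, k2, k3, sub_self]
  rfl

/-- For fixed `q` the summands are backward martingale differences, so the weights enter through
their `ℓ²` norm. -/
theorem eLpNorm_inner_sum_incr_le (h : CausalProcess μ M e X δ) (c : ℤ → ℝ) (T q : ℕ)
    (a : EuclideanSpace ℝ (Fin d)) :
    eLpNorm (fun ω => inner ℝ a (∑ t ∈ Finset.Icc (1 : ℤ) T, c t • winIncr μ e X q (q + 1) t ω))
      (ENNReal.ofReal M) μ ≤ ‖a‖ₑ * (martConst M * δ q *
        ENNReal.ofReal √(∑ t ∈ Finset.Icc (1 : ℤ) T, c t ^ 2)) := by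
  have hM := h.four_lt
  set V : ℤ → Ω → ℝ := fun t => (c t • innerSL ℝ a) ∘ winIncr μ e X q (q + 1) t with hV
  have hlp : ∀ t, MemLp (V t) (ENNReal.ofReal M) μ := fun t =>
    (h.memLp_winIncr q (q + 1) t).continuousLinearMap_comp (c t • innerSL ℝ a)
  have hsm : ∀ t, StronglyMeasurable[sigmaOn e (Set.Ioc (t - (q + 1 : ℕ)) t)] (V t) := fun t =>
    (c t • innerSL ℝ a).continuous.comp_stronglyMeasurable
      (stronglyMeasurable_winIncr (Nat.le_succ q) t)
  have key := sq_eLpNorm_sum_backward_le (p := M) (by linarith)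
    (fun t => sigmaOn e (Set.Ioi (t - q))) (fun t => h.sigmaOn_le _) V hlp
    (fun s t hst => ((hsm t).mono (sigmaOn_mono fun x hx => by
      simp only [Set.mem_Ioc, Set.mem_Ioi] at *; omega)).aestronglyMeasurable)
    (fun t => by
      have h1 := (c t • innerSL ℝ a).comp_condExp_comm (m := sigmaOn e (Set.Ioi (t - q)))
        ((h.memLp_winIncr q (q + 1) t).integrable h.one_le)
      refine h1.symm.trans ?_
      filter_upwards [h.condExp_winIncr_eq_zero (Nat.le_succ q) t] with ω k
      rw [Function.comp_apply, k]
      simp) T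
  have hb := ENNReal.le_mul_sqrt_of_sq_le_sum (k := ‖a‖ₑ * δ q) (r := c) key (fun t _ => by
    have e1 : V t = c t • fun ω => inner ℝ a (winIncr μ e X q (q + 1) t ω) := by
      funext ω
      simp [hV]
    rw [e1, eLpNorm_const_smul, Real.enorm_eq_ofReal_abs]
    gcongr
    exact h.incr_le' q t a)
  have e2 : (fun ω => inner ℝ a (∑ t ∈ Finset.Icc (1 : ℤ) T, c t • winIncr μ e X q (q + 1) t ω))
      = ∑ t ∈ Finset.Icc (1 : ℤ) T, V t := by
    funext ω
    rw [inner_sum, Finset.sum_apply]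
    refine Finset.sum_congr rfl fun t _ => ?_
    simp [hV, inner_smul_right]
  rw [e2]
  refine hb.trans (le_of_eq ?_)
  ring

theorem sum_Ico_le_tsum (n m : ℕ) : ∑ q ∈ Finset.Ico n m, δ q ≤ ∑' j, δ (n + j) := by
  rw [Finset.sum_Ico_eq_sum_range]
  exact ENNReal.sum_le_tsum _

theorem eLpNorm_inner_sum_winIncr_le (h : CausalProcess μ M e X δ) (c : ℤ → ℝ) (T : ℕ) {n m : ℕ}
    (hnm : n ≤ m) (a : EuclideanSpace ℝ (Fin d)) :
    eLpNorm (fun ω => inner ℝ a (∑ t ∈ Finset.Icc (1 : ℤ) T, c t • winIncr μ e X n m t ω))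
      (ENNReal.ofReal M) μ ≤ ‖a‖ₑ * (martConst M * (∑' j, δ (n + j)) *
        ENNReal.ofReal √(∑ t ∈ Finset.Icc (1 : ℤ) T, c t ^ 2)) := by
  have e1 : (fun ω => inner ℝ a (∑ t ∈ Finset.Icc (1 : ℤ) T, c t • winIncr μ e X n m t ω))
      = ∑ q ∈ Finset.Ico n m, fun ω =>
        inner ℝ a (∑ t ∈ Finset.Icc (1 : ℤ) T, c t • winIncr μ e X q (q + 1) t ω) := by
    funext ω
    rw [Finset.sum_apply, ← inner_sum, Finset.sum_comm]
    congr 1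
    refine Finset.sum_congr rfl fun t _ => ?_
    rw [winIncr_eq_sum hnm, Finset.sum_apply, Finset.smul_sum]
  rw [e1]
  refine (eLpNorm_sum_le (fun q _ => ?_) h.one_le).trans ?_
  · exact aestronglyMeasurable_const.inner (h.aestronglyMeasurable_sum_winIncr c T q (q + 1))
  · refine (Finset.sum_le_sum fun q _ => h.eLpNorm_inner_sum_incr_le c T q a).trans ?_
    rw [← Finset.mul_sum, ← Finset.sum_mul, ← Finset.mul_sum]
    gcongr
    exact sum_Ico_le_tsum n m

theorem eLpNorm_sum_winIncr_le (h : CausalProcess μ M e X δ) (c : ℤ → ℝ) (T : ℕ) {n m : ℕ}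
    (hnm : n ≤ m) :
    eLpNorm (fun ω => ∑ t ∈ Finset.Icc (1 : ℤ) T, c t • winIncr μ e X n m t ω)
      (ENNReal.ofReal M) μ ≤ ENNReal.ofReal √d * (martConst M * (∑' j, δ (n + j)) *
        ENNReal.ofReal √(∑ t ∈ Finset.Icc (1 : ℤ) T, c t ^ 2)) :=
  eLpNorm_le_sqrt_mul_of_inner_le (by linarith [h.four_lt])
    (h.aestronglyMeasurable_sum_winIncr c T n m)
    (h.eLpNorm_inner_sum_winIncr_le c T hnm)

/-- Lévy's upward theorem for windows of innovations. -/
theorem ae_tendsto_winExp (h : CausalProcess μ M e X δ) (t : ℤ) :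
    ∀ᵐ ω ∂μ, Tendsto (fun n => winExp μ e X n t ω) atTop (nhds (X t ω)) := by
  let ℱ : Filtration ℕ m0 :=
    { seq := fun n => sigmaOn e (Set.Ioc (t - n) t)
      mono' := fun n m hnm => sigmaOn_mono (Set.Ioc_subset_Ioc_left (by omega))
      le' := fun n => h.sigmaOn_le _ }
  have hsup : sigmaOn e (Set.Iic t) ≤ ⨆ n, ℱ n := by
    refine iSup₂_le fun i hi => ?_
    refine le_iSup_of_le (t - i + 1).toNat ?_
    change _ ≤ sigmaOn e (Set.Ioc (t - ((t - i + 1).toNat : ℤ)) t)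
    refine le_iSup₂_of_le i ?_ le_rfl
    simp only [Set.mem_Iic, Set.mem_Ioc] at *
    omega
  have hcoord : ∀ i : Fin d, ∀ᵐ ω ∂μ,
      Tendsto (fun n => winExp μ e X n t ω i) atTop (nhds (X t ω i)) := fun i => by
    set π : EuclideanSpace ℝ (Fin d) →L[ℝ] ℝ := EuclideanSpace.proj i
    have h1 : Integrable (π ∘ X t) μ := π.integrable_comp (h.integrable t)
    have h2 : StronglyMeasurable[⨆ n, ℱ n] (π ∘ X t) :=
      π.continuous.comp_stronglyMeasurable ((h.adapted t).mono hsup)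
    have h3 := h1.tendsto_ae_condExp h2
    have h4 : ∀ᵐ ω ∂μ, ∀ n, (π ∘ winExp μ e X n t) ω = (μ[π ∘ X t | ℱ n]) ω :=
      ae_all_iff.2 fun n => π.comp_condExp_comm (h.integrable t)
    filter_upwards [h3, h4] with ω k3 k4
    exact k3.congr fun n => (k4 n).symm
  filter_upwards [ae_all_iff.2 hcoord] with ω k
  exact ((PiLp.continuous_toLp 2 _).tendsto _).comp (tendsto_pi_nhds.2 k)

/-- The telescoped bound is uniform in the longer window, which grows to the whole past. -/
theorem eLpNorm_sum_sub_winExp_le (h : CausalProcess μ M e X δ) (c : ℤ → ℝ) (T n : ℕ) :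
    eLpNorm (fun ω => ∑ t ∈ Finset.Icc (1 : ℤ) T, c t • (X t ω - winExp μ e X n t ω))
      (ENNReal.ofReal M) μ ≤ ENNReal.ofReal √d * (martConst M * (∑' j, δ (n + j)) *
        ENNReal.ofReal √(∑ t ∈ Finset.Icc (1 : ℤ) T, c t ^ 2)) := by
  refine eLpNorm_le_of_ae_tendsto (fun m => h.aestronglyMeasurable_sum_winIncr c T n m) ?_
    (eventually_atTop.2 ⟨n, fun m hm => h.eLpNorm_sum_winIncr_le c T hm⟩)
  filter_upwards [ae_all_iff.2 h.ae_tendsto_winExp] with ω k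
  exact tendsto_finsetSum _ fun t _ => ((k t).sub_const _).const_smul _

theorem eLpNorm_sum_smul_le (h : CausalProcess μ M e X δ) (c : ℤ → ℝ) (T : ℕ) :
    eLpNorm (fun ω => ∑ t ∈ Finset.Icc (1 : ℤ) T, c t • X t ω)
      (ENNReal.ofReal M) μ ≤ ENNReal.ofReal √d * (martConst M * (∑' j, δ j) *
        ENNReal.ofReal √(∑ t ∈ Finset.Icc (1 : ℤ) T, c t ^ 2)) := by
  simpa [h.winExp_zero] using h.eLpNorm_sum_sub_winExp_le c T 0

end CausalProcess

/-! ### Bilinear sums for a fixed increment index `q`. -/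

theorem stronglyMeasurable_finset_sum_of_sub {Ω ι E : Type*} [NormedAddCommGroup E]
    {G : MeasurableSpace Ω} {s : Finset ι} {X : ι → Ω → E}
    (h : ∀ i ∈ s, StronglyMeasurable[G] (X i)) :
    StronglyMeasurable[G] (fun ω => ∑ i ∈ s, X i ω) := by
  have := Finset.sum_induction X (fun f => StronglyMeasurable[G] f) (fun _ _ h1 h2 => h1.add h2)
    stronglyMeasurable_zero h
  convert this using 1
  funext ω
  rw [Finset.sum_apply]

namespace CausalProcess

variable {Ω S : Type*} {m0 : MeasurableSpace Ω} [MeasurableSpace S] {μ : Measure Ω}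
  {M : ℝ} {e : ℤ → Ω → S} {d : ℕ}
  {X : ℤ → Ω → EuclideanSpace ℝ (Fin d)} {δ : ℕ → ℝ≥0∞}

theorem stronglyMeasurable_sum_winIncr {c : ℤ → ℝ} {T n m : ℕ} {A : Set ℤ} (hnm : n ≤ m)
    (hc : ∀ t, c t ≠ 0 → Set.Ioc (t - (m : ℤ)) t ⊆ A) :
    StronglyMeasurable[sigmaOn e A]
      (fun ω => ∑ t ∈ Finset.Icc (1 : ℤ) T, c t • winIncr μ e X n m t ω) := by
  refine stronglyMeasurable_finset_sum_of_sub
    (X := fun t ω => c t • winIncr μ e X n m t ω) fun t _ => ?_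
  rcases eq_or_ne (c t) 0 with h0 | h0
  · simp only [h0, zero_smul]
    exact stronglyMeasurable_zero
  · exact ((stronglyMeasurable_winIncr hnm t).mono (sigmaOn_mono (hc t h0))).const_smul (c t)

theorem memLp_sum_winIncr (h : CausalProcess μ M e X δ) (c : ℤ → ℝ) (T n m : ℕ) :
    MemLp (fun ω => ∑ t ∈ Finset.Icc (1 : ℤ) T, c t • winIncr μ e X n m t ω)
      (ENNReal.ofReal M) μ :=
  memLp_finsetSum _ fun t _ => (h.memLp_winIncr n m t).const_smul (c t)

variable [IsProbabilityMeasure μ]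

/-- Summation over the first index: for a fixed lag `q`, increments times functions of later
innovations are backward martingale differences. -/
theorem eLpNorm_sum_inner_incr_le (h : CausalProcess μ M e X δ) (T q : ℕ)
    {Y : ℤ → Ω → EuclideanSpace ℝ (Fin d)}
    (hY : ∀ t, StronglyMeasurable[sigmaOn e (Set.Ioi (t - q))] (Y t))
    (hYlp : ∀ t, MemLp (Y t) (ENNReal.ofReal M) μ) {k : ℝ≥0∞} {r : ℤ → ℝ}
    (hb : ∀ t ∈ Finset.Icc (1 : ℤ) T,
      eLpNorm (fun ω => inner ℝ (winIncr μ e X q (q + 1) t ω) (Y t ω)) (ENNReal.ofReal (M / 2)) μ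
        ≤ ENNReal.ofReal |r t| * k) :
    eLpNorm (fun ω => ∑ t ∈ Finset.Icc (1 : ℤ) T,
      inner ℝ (winIncr μ e X q (q + 1) t ω) (Y t ω)) (ENNReal.ofReal (M / 2)) μ
      ≤ martConst (M / 2) *
        (k * ENNReal.ofReal √(∑ t ∈ Finset.Icc (1 : ℤ) T, r t ^ 2)) := by
  have hM := h.four_lt
  set V : ℤ → Ω → ℝ := fun t ω => inner ℝ (winIncr μ e X q (q + 1) t ω) (Y t ω) with hV
  have hD : ∀ t, StronglyMeasurable[sigmaOn e (Set.Ioc (t - (q + 1 : ℕ)) t)]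
      (winIncr μ e X q (q + 1) t) := stronglyMeasurable_winIncr (Nat.le_succ q)
  -- `M > 4` makes the exponent at least `2`. For `s < t` the term at `t` involves no innovation
  -- before `e_{t-q}`, and `t - q > s - q`, so it is known when the term at `s` is added.
  have key := sq_eLpNorm_sum_backward_le (p := M / 2) (by linarith)
    (fun t => sigmaOn e (Set.Ioi (t - q))) (fun t => h.sigmaOn_le _) V
    (fun t => (h.memLp_winIncr q (q + 1) t).inner_half (by linarith) (hYlp t))
    (fun s t hst => by
      refine StronglyMeasurable.aestronglyMeasurable (StronglyMeasurable.inner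
        ((hD t).mono (sigmaOn_mono fun x hx => ?_)) ((hY t).mono (sigmaOn_mono fun x hx => ?_)))
      · simp only [Set.mem_Ioc, Set.mem_Ioi] at *; omega
      · simp only [Set.mem_Ioi] at *; omega)
    (fun t => by
      refine (condExp_inner_of_right (M := M) (by linarith) (h.memLp_winIncr q (q + 1) t) (hYlp t)
        (hY t).aestronglyMeasurable).trans ?_
      filter_upwards [h.condExp_winIncr_eq_zero (Nat.le_succ q) t] with ω k
      rw [k]
      simp) T
  have hsum : (fun ω => ∑ t ∈ Finset.Icc (1 : ℤ) T,
      inner ℝ (winIncr μ e X q (q + 1) t ω) (Y t ω)) = ∑ t ∈ Finset.Icc (1 : ℤ) T, V t := by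
    funext ω
    rw [Finset.sum_apply]
  rw [hsum]
  exact ENNReal.le_mul_sqrt_of_sq_le_sum key hb

theorem sum_sq_sqrt (c : ℤ → ℤ → ℝ) (T : ℕ) :
    ∑ t₁ ∈ Finset.Icc (1 : ℤ) T, √(∑ t₂ ∈ Finset.Icc (1 : ℤ) T, c t₁ t₂ ^ 2) ^ 2
      = ∑ t₁ ∈ Finset.Icc (1 : ℤ) T, ∑ t₂ ∈ Finset.Icc (1 : ℤ) T, c t₁ t₂ ^ 2 :=
  Finset.sum_congr rfl fun _ _ => Real.sq_sqrt (Finset.sum_nonneg fun _ _ => sq_nonneg _)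

/-- Lagged products in which the second factor is independent of the first one. -/
theorem eLpNorm_sum_incr_winExp_le (h : CausalProcess μ M e X δ) (c : ℤ → ℤ → ℝ) (T q n : ℕ)
    (hc : ∀ t₁ t₂, c t₁ t₂ ≠ 0 → (n : ℤ) ≤ t₂ - t₁) :
    eLpNorm (fun ω => ∑ t₁ ∈ Finset.Icc (1 : ℤ) T, inner ℝ (winIncr μ e X q (q + 1) t₁ ω)
      (∑ t₂ ∈ Finset.Icc (1 : ℤ) T, c t₁ t₂ • winExp μ e X n t₂ ω)) (ENNReal.ofReal (M / 2)) μ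
      ≤ martConst (M / 2) * (δ q * (ENNReal.ofReal √d * (martConst M * ∑' j, δ j)) *
        ENNReal.ofReal
          √(∑ t₁ ∈ Finset.Icc (1 : ℤ) T, ∑ t₂ ∈ Finset.Icc (1 : ℤ) T, c t₁ t₂ ^ 2)) := by
  have hM := h.four_lt
  simp_rw [← h.winIncr_zero]
  set Y : ℤ → Ω → EuclideanSpace ℝ (Fin d) := fun t₁ ω =>
    ∑ t₂ ∈ Finset.Icc (1 : ℤ) T, c t₁ t₂ • winIncr μ e X 0 n t₂ ω with hY
  -- Lags of at least `n` place the windows of length `n` at `t₂` strictly after `t`, away from the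
  -- innovations of the increment.
  have hYs : ∀ t, StronglyMeasurable[sigmaOn e (Set.Ioi t)] (Y t) := fun t =>
    stronglyMeasurable_sum_winIncr (Nat.zero_le n) fun t₂ h0 x hx => by
      have := hc t t₂ h0
      simp only [Set.mem_Ioc, Set.mem_Ioi] at *
      omega
  have hD : ∀ t, StronglyMeasurable[sigmaOn e (Set.Ioc (t - (q + 1 : ℕ)) t)]
      (winIncr μ e X q (q + 1) t) := stronglyMeasurable_winIncr (Nat.le_succ q)
  rw [← sum_sq_sqrt]
  refine h.eLpNorm_sum_inner_incr_le T q (Y := Y)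
    (fun t => (hYs t).mono (sigmaOn_mono (Set.Ioi_subset_Ioi (by omega))))
    (fun t => h.memLp_sum_winIncr _ T 0 n) fun t _ => ?_
  have hind : IndepFun (Y t) (winIncr μ e X q (q + 1) t) μ := by
    rw [IndepFun_iff_Indep]
    refine indep_of_indep_of_le_left (indep_of_indep_of_le_right
      (indep_sigmaOn h.measurable_e h.indep (A := Set.Ioi t) (B := Set.Ioc (t - (q + 1 : ℕ)) t) ?_)
      (hD t).measurable.comap_le) (hYs t).measurable.comap_le
    rw [Set.disjoint_left]
    intro x hx hx'
    simp only [Set.mem_Ioc, Set.mem_Ioi] at *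
    omega
  have hDl := h.memLp_winIncr q (q + 1) t
  have hYl := h.memLp_sum_winIncr (c t) T 0 n
  have h1 := eLpNorm_inner_le_of_indepFun (p := M) (by linarith) hDl.1.aemeasurable
    hYl.1.aemeasurable hind (h.incr_le' q t)
  have h2 := h.eLpNorm_sum_winIncr_le (c t) T (Nat.zero_le n)
  simp only [zero_add] at h2
  rw [abs_of_nonneg (Real.sqrt_nonneg _)]
  calc _ ≤ eLpNorm (fun ω => inner ℝ (winIncr μ e X q (q + 1) t ω) (Y t ω))
        (ENNReal.ofReal M) μ :=
        eLpNorm_le_eLpNorm_of_exponent_le (ENNReal.ofReal_le_ofReal (by linarith))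
          (hDl.1.inner hYl.1)
    _ ≤ _ := h1
    _ ≤ δ q * (ENNReal.ofReal √d * (martConst M * (∑' j, δ j) *
          ENNReal.ofReal √(∑ t₂ ∈ Finset.Icc (1 : ℤ) T, c t t₂ ^ 2))) := mul_le_mul' le_rfl h2
    _ = _ := by ring

/-- Lagged products estimated by the Cauchy–Schwarz inequality for fixed first index. -/
theorem eLpNorm_sum_incr_winIncr_le (h : CausalProcess μ M e X δ) (c : ℤ → ℤ → ℝ) (T q : ℕ)
    {n m : ℕ} (hnm : n ≤ m) (hc : ∀ t₁ t₂, c t₁ t₂ ≠ 0 → t₁ - (q : ℤ) ≤ t₂ - m) :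
    eLpNorm (fun ω => ∑ t₁ ∈ Finset.Icc (1 : ℤ) T, inner ℝ (winIncr μ e X q (q + 1) t₁ ω)
      (∑ t₂ ∈ Finset.Icc (1 : ℤ) T, c t₁ t₂ • winIncr μ e X n m t₂ ω)) (ENNReal.ofReal (M / 2)) μ
      ≤ martConst (M / 2) * (ENNReal.ofReal √d * δ q *
        (ENNReal.ofReal √d * (martConst M * ∑' j, δ (n + j))) *
        ENNReal.ofReal
          √(∑ t₁ ∈ Finset.Icc (1 : ℤ) T, ∑ t₂ ∈ Finset.Icc (1 : ℤ) T, c t₁ t₂ ^ 2)) := by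
  have hM := h.four_lt
  rw [← sum_sq_sqrt]
  refine h.eLpNorm_sum_inner_incr_le T q
    (fun t => stronglyMeasurable_sum_winIncr hnm fun t₂ h0 x hx => ?_)
    (fun t => h.memLp_sum_winIncr _ T n m) fun t _ => ?_
  · have := hc t t₂ h0
    simp only [Set.mem_Ioc, Set.mem_Ioi] at *
    omega
  · rw [abs_of_nonneg (Real.sqrt_nonneg _)]
    refine (eLpNorm_inner_le (by linarith) (h.memLp_winIncr q (q + 1) t).1
      (h.memLp_sum_winIncr (c t) T n m).1).trans ?_
    refine (mul_le_mul' (h.eLpNorm_incr_le q t) (h.eLpNorm_sum_winIncr_le (c t) T hnm)).trans ?_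
    refine le_of_eq ?_
    ring

/-- Summation of the bounds for fixed lag `q` over all lags beyond `k t₁ t₂`. -/
theorem eLpNorm_sum_inner_sub_winExp_le (h : CausalProcess μ M e X δ) (c : ℤ → ℤ → ℝ) (T : ℕ)
    (k : ℤ → ℤ → ℕ) (K : ℕ)
    (hk : ∀ t₁ ∈ Finset.Icc (1 : ℤ) T, ∀ t₂ ∈ Finset.Icc (1 : ℤ) T, k t₁ t₂ ≤ K)
    {Z : ℤ → Ω → EuclideanSpace ℝ (Fin d)} (hZ : ∀ t, AEStronglyMeasurable (Z t) μ)
    {β : ℕ → ℝ≥0∞}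
    (hβ : ∀ q, eLpNorm (fun ω => ∑ t₁ ∈ Finset.Icc (1 : ℤ) T,
      inner ℝ (winIncr μ e X q (q + 1) t₁ ω) (∑ t₂ ∈ Finset.Icc (1 : ℤ) T,
        (if k t₁ t₂ ≤ q then c t₁ t₂ else 0) • Z t₂ ω)) (ENNReal.ofReal (M / 2)) μ ≤ β q) :
    eLpNorm (fun ω => ∑ t₁ ∈ Finset.Icc (1 : ℤ) T, ∑ t₂ ∈ Finset.Icc (1 : ℤ) T,
      c t₁ t₂ * inner ℝ (X t₁ ω - winExp μ e X (k t₁ t₂) t₁ ω) (Z t₂ ω))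
      (ENNReal.ofReal (M / 2)) μ ≤ ∑' q, β q := by
  set f : ℕ → Ω → ℝ := fun q ω => ∑ t₁ ∈ Finset.Icc (1 : ℤ) T,
      inner ℝ (winIncr μ e X q (q + 1) t₁ ω) (∑ t₂ ∈ Finset.Icc (1 : ℤ) T,
        (if k t₁ t₂ ≤ q then c t₁ t₂ else 0) • Z t₂ ω) with hf
  have hfm : ∀ q, AEStronglyMeasurable (f q) μ := fun q =>
    Finset.aestronglyMeasurable_fun_sum _ fun t₁ _ =>
      (h.memLp_winIncr q (q + 1) t₁).1.inner
        (Finset.aestronglyMeasurable_fun_sum _ fun t₂ _ =>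
          (hZ t₂).const_smul (if k t₁ t₂ ≤ q then c t₁ t₂ else 0))
  -- The indicator `k t₁ t₂ ≤ q` starts each telescoping sum at its own index; `m ≥ K` ensures that
  -- all of them have started.
  have hpart : ∀ m, K ≤ m → ∀ ω, (∑ q ∈ Finset.range m, f q) ω =
      ∑ t₁ ∈ Finset.Icc (1 : ℤ) T, ∑ t₂ ∈ Finset.Icc (1 : ℤ) T,
      c t₁ t₂ * inner ℝ (winExp μ e X m t₁ ω - winExp μ e X (k t₁ t₂) t₁ ω) (Z t₂ ω) := by
    intro m hm ω
    rw [Finset.sum_apply]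
    simp only [hf]
    rw [Finset.sum_comm]
    refine Finset.sum_congr rfl fun t₁ ht₁ => ?_
    simp_rw [inner_sum]
    rw [Finset.sum_comm]
    refine Finset.sum_congr rfl fun t₂ ht₂ => ?_
    have hle : k t₁ t₂ ≤ m := (hk t₁ ht₁ t₂ ht₂).trans hm
    have e1 : winExp μ e X m t₁ ω - winExp μ e X (k t₁ t₂) t₁ ω
        = ∑ q ∈ Finset.Ico (k t₁ t₂) m, winIncr μ e X q (q + 1) t₁ ω := by
      have := congrFun (winIncr_eq_sum (μ := μ) (e := e) (X := X) hle t₁) ω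
      rwa [Finset.sum_apply] at this
    rw [e1, sum_inner, Finset.mul_sum]
    have e2 : Finset.Ico (k t₁ t₂) m = (Finset.range m).filter (fun q => k t₁ t₂ ≤ q) := by
      ext q
      simp only [Finset.mem_Ico, Finset.mem_filter, Finset.mem_range]
      omega
    rw [e2, Finset.sum_filter]
    refine Finset.sum_congr rfl fun q _ => ?_
    split_ifs with hq
    · rw [inner_smul_right]
    · simp
  refine eLpNorm_le_of_ae_tendsto (f := fun m => ∑ q ∈ Finset.range m, f q)
    (fun m => Finset.aestronglyMeasurable_sum _ fun q _ => hfm q) ?_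
    (Eventually.of_forall fun m => ?_)
  · filter_upwards [ae_all_iff.2 h.ae_tendsto_winExp] with ω hω
    have hlim : Tendsto (fun m => ∑ t₁ ∈ Finset.Icc (1 : ℤ) T, ∑ t₂ ∈ Finset.Icc (1 : ℤ) T,
      c t₁ t₂ * inner ℝ (winExp μ e X m t₁ ω - winExp μ e X (k t₁ t₂) t₁ ω) (Z t₂ ω)) atTop
      (nhds (∑ t₁ ∈ Finset.Icc (1 : ℤ) T, ∑ t₂ ∈ Finset.Icc (1 : ℤ) T,
        c t₁ t₂ * inner ℝ (X t₁ ω - winExp μ e X (k t₁ t₂) t₁ ω) (Z t₂ ω))) :=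
      tendsto_finsetSum _ fun t₁ _ => tendsto_finsetSum _ fun t₂ _ =>
        (((hω t₁).sub_const _).inner tendsto_const_nhds).const_mul _
    refine hlim.congr' ?_
    filter_upwards [eventually_ge_atTop K] with m hm
    exact (hpart m hm ω).symm
  · exact (eLpNorm_sum_le (fun q _ => hfm q) h.one_le_half).trans
      ((Finset.sum_le_sum fun q _ => hβ q).trans (ENNReal.sum_le_tsum _))

end CausalProcess

/-! ### Decomposition of centered quadratic forms. -/

namespace CausalProcess

variable {Ω S : Type*} {m0 : MeasurableSpace Ω} [MeasurableSpace S] {μ : Measure Ω}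
  [IsProbabilityMeasure μ] {M : ℝ} {e : ℤ → Ω → S} {d : ℕ}
  {X : ℤ → Ω → EuclideanSpace ℝ (Fin d)} {δ : ℕ → ℝ≥0∞}

theorem sum_sq_le_of_abs_le_one {c : ℤ → ℝ} {T : ℕ}
    (hc : ∀ t ∈ Finset.Icc (1 : ℤ) T, |c t| ≤ 1) :
    ∑ t ∈ Finset.Icc (1 : ℤ) T, c t ^ 2 ≤ T := by
  calc ∑ t ∈ Finset.Icc (1 : ℤ) T, c t ^ 2 ≤ ∑ t ∈ Finset.Icc (1 : ℤ) T, (1 : ℝ) :=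
        Finset.sum_le_sum fun t ht => (sq_le_one_iff_abs_le_one _).2 (hc t ht)
    _ = T := by simp

theorem eLpNorm_sub_winExp_le (h : CausalProcess μ M e X δ) {T : ℕ} {t : ℤ}
    (ht : t ∈ Finset.Icc (1 : ℤ) T) (n : ℕ) :
    eLpNorm (X t - winExp μ e X n t) (ENNReal.ofReal M) μ
      ≤ ENNReal.ofReal √d * (martConst M * ∑' j, δ (n + j)) := by
  have h1 := h.eLpNorm_sum_sub_winExp_le (fun s => if s = t then 1 else 0) T n
  simpa [ht, ite_smul, ite_pow] using! h1

/-- The contribution of the parts of the second factors not explained by the last `n`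
innovations. -/
theorem eLpNorm_sum_remainder_le (h : CausalProcess μ M e X δ) {c : ℤ → ℤ → ℝ} {T : ℕ} (n : ℕ)
    (hc : ∀ t₁ ∈ Finset.Icc (1 : ℤ) T, ∀ t₂ ∈ Finset.Icc (1 : ℤ) T, |c t₁ t₂| ≤ 1)
    (G : ℤ → MeasurableSpace Ω) :
    eLpNorm (∑ t₂ ∈ Finset.Icc (1 : ℤ) T,
      ((fun ω => (inner ℝ (∑ t₁ ∈ Finset.Icc (1 : ℤ) T, c t₁ t₂ • X t₁ ω)
        (X t₂ ω - winExp μ e X n t₂ ω) : ℝ)) -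
      μ[fun ω => (inner ℝ (∑ t₁ ∈ Finset.Icc (1 : ℤ) T, c t₁ t₂ • X t₁ ω)
        (X t₂ ω - winExp μ e X n t₂ ω) : ℝ) | G t₂])) (ENNReal.ofReal (M / 2)) μ
      ≤ 2 * ((ENNReal.ofReal √d * (martConst M * ∑' j, δ j)) *
        (ENNReal.ofReal √d * (martConst M * ∑' j, δ (n + j)))) * ENNReal.ofReal (T * √T) := by
  have hM := h.four_lt
  set A := ENNReal.ofReal √d * (martConst M * ∑' j, δ j)
  set R := ENNReal.ofReal √d * (martConst M * ∑' j, δ (n + j))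
  set W : ℤ → Ω → ℝ := fun t₂ ω => inner ℝ (∑ t₁ ∈ Finset.Icc (1 : ℤ) T, c t₁ t₂ • X t₁ ω)
        (X t₂ ω - winExp μ e X n t₂ ω) with hW
  have hS : ∀ t₂, MemLp (fun ω => ∑ t₁ ∈ Finset.Icc (1 : ℤ) T, c t₁ t₂ • X t₁ ω)
      (ENNReal.ofReal M) μ := fun t₂ =>
    memLp_finsetSum _ fun t₁ _ => (h.memLp t₁).const_smul (c t₁ t₂)
  have hy : ∀ t, MemLp (X t - winExp μ e X n t) (ENNReal.ofReal M) μ := fun t =>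
    (h.memLp t).sub (h.memLp_winExp n t)
  have hWm : ∀ t, AEStronglyMeasurable (W t) μ := fun t => (hS t).1.inner (hy t).1
  -- Summing over `t₁` inside the norm costs only `√T`; the plain triangle inequality is used for
  -- `t₂` alone, whence `T * √T`.
  have hWb : ∀ t₂ ∈ Finset.Icc (1 : ℤ) T,
      eLpNorm (W t₂) (ENNReal.ofReal (M / 2)) μ ≤ A * ENNReal.ofReal √T * R := by
    intro t₂ ht₂
    refine (eLpNorm_inner_le (by linarith) (hS t₂).1 (hy t₂).1).trans ?_
    refine mul_le_mul' ((h.eLpNorm_sum_smul_le (fun t₁ => c t₁ t₂) T).trans ?_)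
      (h.eLpNorm_sub_winExp_le ht₂ n)
    rw [← mul_assoc]
    refine mul_le_mul' le_rfl (ENNReal.ofReal_le_ofReal (Real.sqrt_le_sqrt ?_))
    exact sum_sq_le_of_abs_le_one fun t₁ ht₁ => hc t₁ ht₁ t₂ ht₂
  refine (eLpNorm_sum_le (fun t _ => (hWm t).sub integrable_condExp.1) h.one_le_half).trans ?_
  calc _ ≤ ∑ t₂ ∈ Finset.Icc (1 : ℤ) T, 2 * (A * ENNReal.ofReal √T * R) := by
        refine Finset.sum_le_sum fun t₂ ht₂ => ?_
        refine (eLpNorm_sub_le (hWm t₂) integrable_condExp.1 h.one_le_half).trans ?_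
        rw [two_mul]
        exact add_le_add (hWb t₂ ht₂)
          ((eLpNorm_condExp_le_eLpNorm _ h.one_le_half).trans (hWb t₂ ht₂))
    _ = _ := by
        rw [Finset.sum_const, ENNReal.ofReal_mul (Nat.cast_nonneg T), ENNReal.ofReal_natCast]
        simp
        ring

/-- Decomposition of a centered quadratic form whose second factors are replaced by their
conditional expectations given the last `n` innovations. -/
theorem eLpNorm_centered_le (h : CausalProcess μ M e X δ) {c : ℤ → ℤ → ℝ} {T : ℕ} (n : ℕ)
    (hc : ∀ t₁ ∈ Finset.Icc (1 : ℤ) T, ∀ t₂ ∈ Finset.Icc (1 : ℤ) T, |c t₁ t₂| ≤ 1)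
    (G : ℤ → MeasurableSpace Ω) (k : ℤ → ℤ → ℕ) (K : ℕ)
    (hk : ∀ t₁ ∈ Finset.Icc (1 : ℤ) T, ∀ t₂ ∈ Finset.Icc (1 : ℤ) T, k t₁ t₂ ≤ K)
    (hpull : ∀ t₁ t₂, c t₁ t₂ ≠ 0 →
      μ[fun ω => (inner ℝ (X t₁ ω) (winExp μ e X n t₂ ω) : ℝ) | G t₂] =ᵐ[μ]
        fun ω => inner ℝ (winExp μ e X (k t₁ t₂) t₁ ω) (winExp μ e X n t₂ ω))
    {β : ℕ → ℝ≥0∞}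
    (hβ : ∀ q, eLpNorm (fun ω => ∑ t₁ ∈ Finset.Icc (1 : ℤ) T,
      inner ℝ (winIncr μ e X q (q + 1) t₁ ω) (∑ t₂ ∈ Finset.Icc (1 : ℤ) T,
        (if k t₁ t₂ ≤ q then c t₁ t₂ else 0) • winExp μ e X n t₂ ω))
          (ENNReal.ofReal (M / 2)) μ ≤ β q) :
    eLpNorm (fun ω => ∑ t₁ ∈ Finset.Icc (1 : ℤ) T, ∑ t₂ ∈ Finset.Icc (1 : ℤ) T,
      c t₁ t₂ * (inner ℝ (X t₁ ω) (X t₂ ω) -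
        (μ[fun ω' => (inner ℝ (X t₁ ω') (X t₂ ω') : ℝ) | G t₂]) ω)) (ENNReal.ofReal (M / 2)) μ
      ≤ ∑' q, β q + 2 * ((ENNReal.ofReal √d * (martConst M * ∑' j, δ j)) *
        (ENNReal.ofReal √d * (martConst M * ∑' j, δ (n + j)))) * ENNReal.ofReal (T * √T) := by
  have hM := h.four_lt
  have hy : ∀ t, MemLp (X t - winExp μ e X n t) (ENNReal.ofReal M) μ := fun t =>
    (h.memLp t).sub (h.memLp_winExp n t)
  have hint : ∀ {U V : Ω → EuclideanSpace ℝ (Fin d)}, MemLp U (ENNReal.ofReal M) μ →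
      MemLp V (ENNReal.ofReal M) μ → Integrable (fun ω => (inner ℝ (U ω) (V ω) : ℝ)) μ :=
    fun hU hV => (hU.inner_half (by linarith) hV).integrable h.one_le_half
  set P : Ω → ℝ := fun ω => ∑ t₁ ∈ Finset.Icc (1 : ℤ) T, ∑ t₂ ∈ Finset.Icc (1 : ℤ) T,
      c t₁ t₂ * inner ℝ (X t₁ ω - winExp μ e X (k t₁ t₂) t₁ ω) (winExp μ e X n t₂ ω) with hP
  set W : ℤ → Ω → ℝ := fun t₂ ω => inner ℝ (∑ t₁ ∈ Finset.Icc (1 : ℤ) T, c t₁ t₂ • X t₁ ω)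
        (X t₂ ω - winExp μ e X n t₂ ω) with hW
  set y : ℤ → ℤ → Ω → ℝ := fun t₁ t₂ ω => inner ℝ (X t₁ ω) (X t₂ ω - winExp μ e X n t₂ ω) with hy'
  have hyi : ∀ t₁ t₂, Integrable (y t₁ t₂) μ := fun t₁ t₂ => hint (h.memLp t₁) (hy t₂)
  have hWexp : ∀ t₂, W t₂ = ∑ t₁ ∈ Finset.Icc (1 : ℤ) T, c t₁ t₂ • y t₁ t₂ := fun t₂ => by
    funext ω
    simp [hW, hy', sum_inner, inner_smul_left]
  have hWc : ∀ t₂, μ[W t₂ | G t₂] =ᵐ[μ]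
      ∑ t₁ ∈ Finset.Icc (1 : ℤ) T, c t₁ t₂ • μ[y t₁ t₂ | G t₂] := fun t₂ => by
    rw [hWexp]
    refine (condExp_finsetSum (fun t₁ _ => (hyi t₁ t₂).smul _) _).trans ?_
    have : ∀ᵐ ω ∂μ, ∀ t₁, (μ[c t₁ t₂ • y t₁ t₂ | G t₂]) ω = (c t₁ t₂ • μ[y t₁ t₂ | G t₂]) ω :=
      ae_all_iff.2 fun t₁ => condExp_smul _ _ _
    filter_upwards [this] with ω hω
    simp only [Finset.sum_apply, hω]
  have hsplit : ∀ t₁ t₂, c t₁ t₂ ≠ 0 →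
      μ[fun ω => (inner ℝ (X t₁ ω) (X t₂ ω) : ℝ) | G t₂] =ᵐ[μ] fun ω =>
        inner ℝ (winExp μ e X (k t₁ t₂) t₁ ω) (winExp μ e X n t₂ ω) + (μ[y t₁ t₂ | G t₂]) ω := by
    intro t₁ t₂ h0
    have e1 : (fun ω => (inner ℝ (X t₁ ω) (X t₂ ω) : ℝ))
        = (fun ω => (inner ℝ (X t₁ ω) (winExp μ e X n t₂ ω) : ℝ)) + y t₁ t₂ := by
      funext ω
      simp [hy', inner_sub_right]
    rw [e1]
    refine (condExp_add (hint (h.memLp t₁) (h.memLp_winExp n t₂)) (hyi t₁ t₂) _).trans ?_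
    filter_upwards [hpull t₁ t₂ h0] with ω hω
    rw [Pi.add_apply, hω]
  -- Because `G` depends on `t₂` alone, the terms with `X t₂ - winExp n t₂` can be summed over `t₁`
  -- before conditioning. The other terms are explicit by `hpull`.
  have hae : (fun ω => ∑ t₁ ∈ Finset.Icc (1 : ℤ) T, ∑ t₂ ∈ Finset.Icc (1 : ℤ) T,
      c t₁ t₂ * (inner ℝ (X t₁ ω) (X t₂ ω) -
        (μ[fun ω' => (inner ℝ (X t₁ ω') (X t₂ ω') : ℝ) | G t₂]) ω)) =ᵐ[μ]
      P + ∑ t₂ ∈ Finset.Icc (1 : ℤ) T, (W t₂ - μ[W t₂ | G t₂]) := by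
    have a1 : ∀ᵐ ω ∂μ, ∀ t₁ t₂, c t₁ t₂ ≠ 0 →
        (μ[fun ω => (inner ℝ (X t₁ ω) (X t₂ ω) : ℝ) | G t₂]) ω =
          inner ℝ (winExp μ e X (k t₁ t₂) t₁ ω) (winExp μ e X n t₂ ω) + (μ[y t₁ t₂ | G t₂]) ω := by
      refine ae_all_iff.2 fun t₁ => ae_all_iff.2 fun t₂ => ?_
      by_cases h0 : c t₁ t₂ = 0
      · simp [h0]
      · filter_upwards [hsplit t₁ t₂ h0] with ω hω _ using hω
    filter_upwards [a1, ae_all_iff.2 hWc] with ω b1 b2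
    have e2 : ∀ t₂, (W t₂ - μ[W t₂ | G t₂]) ω = ∑ t₁ ∈ Finset.Icc (1 : ℤ) T,
        c t₁ t₂ * (y t₁ t₂ ω - (μ[y t₁ t₂ | G t₂]) ω) := fun t₂ => by
      rw [Pi.sub_apply, b2 t₂, hWexp]
      simp [Finset.sum_apply, mul_sub, Finset.sum_sub_distrib]
    rw [Pi.add_apply, Finset.sum_apply, Finset.sum_congr rfl fun t₂ _ => e2 t₂, Finset.sum_comm
      (s := Finset.Icc (1 : ℤ) T) (t := Finset.Icc (1 : ℤ) T) (f := fun t₂ t₁ =>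
        c t₁ t₂ * (y t₁ t₂ ω - (μ[y t₁ t₂ | G t₂]) ω)), ← Finset.sum_add_distrib]
    refine Finset.sum_congr rfl fun t₁ _ => ?_
    rw [← Finset.sum_add_distrib]
    refine Finset.sum_congr rfl fun t₂ _ => ?_
    rw [← mul_add]
    by_cases h0 : c t₁ t₂ = 0
    · simp [h0]
    · rw [b1 t₁ t₂ h0]
      simp only [hy', inner_sub_left, inner_sub_right]
      ring
  have hPm : AEStronglyMeasurable P μ :=
    Finset.aestronglyMeasurable_fun_sum _ fun t₁ _ =>
      Finset.aestronglyMeasurable_fun_sum _ fun t₂ _ =>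
        ((((h.memLp t₁).sub (h.memLp_winExp _ t₁)).1.inner (h.memLp_winExp n t₂).1).const_mul
          (c t₁ t₂))
  have hWm : ∀ t, AEStronglyMeasurable (W t) μ := fun t =>
    (memLp_finsetSum _ fun t₁ _ => (h.memLp t₁).const_smul (c t₁ t) :
      MemLp (fun ω => ∑ t₁ ∈ Finset.Icc (1 : ℤ) T, c t₁ t • X t₁ ω) (ENNReal.ofReal M) μ).1.inner
      (hy t).1
  rw [eLpNorm_congr_ae hae]
  refine (eLpNorm_add_le hPm (Finset.aestronglyMeasurable_sum _ fun t _ =>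
    (hWm t).sub integrable_condExp.1) h.one_le_half).trans (add_le_add ?_ ?_)
  · exact h.eLpNorm_sum_inner_sub_winExp_le c T k K hk (fun t => (h.memLp_winExp n t).1) hβ
  · exact h.eLpNorm_sum_remainder_le n hc G

end CausalProcess

/-! ### Bounds for triangular coefficients. -/

namespace CausalProcess

variable {Ω S : Type*} {m0 : MeasurableSpace Ω} [MeasurableSpace S] {μ : Measure Ω}
  [IsProbabilityMeasure μ] {M : ℝ} {e : ℤ → Ω → S} {d : ℕ}
  {X : ℤ → Ω → EuclideanSpace ℝ (Fin d)} {δ : ℕ → ℝ≥0∞}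

/-- Given the innovations after `t₁`, the second factor is known and `X t₁` has conditional mean
zero. -/
theorem integral_inner_winExp_eq_zero (h : CausalProcess μ M e X δ) {t₁ t₂ : ℤ} {n : ℕ}
    (hn : (n : ℤ) ≤ t₂ - t₁) : ∫ ω, inner ℝ (X t₁ ω) (winExp μ e X n t₂ ω) ∂μ = 0 := by
  have hM := h.four_lt
  rw [← integral_condExp (h.sigmaOn_le (Set.Ioi t₁))]
  refine integral_eq_zero_of_ae ?_
  have h1 := h.condExp_eq (Set.Ioi t₁) t₁
  rw [Set.Ioi_inter_Iic, Set.Ioc_self, sigmaOn_empty, condExp_bot, h.mean_zero] at h1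
  have h2 := condExp_inner_of_right (G := sigmaOn e (Set.Ioi t₁)) (by linarith) (h.memLp t₁)
    (h.memLp_winExp n t₂)
    ((stronglyMeasurable_winExp n t₂).mono (sigmaOn_mono fun x hx => by
      simp only [Set.mem_Ioc, Set.mem_Ioi] at *; omega)).aestronglyMeasurable
  filter_upwards [h1, h2] with ω k1 k2
  rw [k2, k1]
  simp

/-- Moment bound for quadratic forms whose coefficients vanish unless `t₂ - t₁ ≥ n`. -/
theorem eLpNorm_upper_quadForm_le (h : CausalProcess μ M e X δ) {c : ℤ → ℤ → ℝ} {T : ℕ} (n : ℕ)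
    (hc1 : ∀ t₁ ∈ Finset.Icc (1 : ℤ) T, ∀ t₂ ∈ Finset.Icc (1 : ℤ) T, |c t₁ t₂| ≤ 1)
    (hc : ∀ t₁ t₂, c t₁ t₂ ≠ 0 → (n : ℤ) ≤ t₂ - t₁) :
    eLpNorm (quadForm μ X c T) (ENNReal.ofReal (M / 2)) μ
      ≤ martConst (M / 2) * ((∑' j, δ j) * (ENNReal.ofReal √d * (martConst M * ∑' j, δ j)) *
        ENNReal.ofReal
          √(∑ t₁ ∈ Finset.Icc (1 : ℤ) T, ∑ t₂ ∈ Finset.Icc (1 : ℤ) T, c t₁ t₂ ^ 2))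
        + 2 * ((ENNReal.ofReal √d * (martConst M * ∑' j, δ j)) *
        (ENNReal.ofReal √d * (martConst M * ∑' j, δ (n + j)))) * ENNReal.ofReal (T * √T) := by
  -- Conditioning on `⊥` is taking expectations. The windowed products have mean zero, which matches
  -- `k = 0` since the empty-window expectation vanishes.
  have key := h.eLpNorm_centered_le n hc1 (fun _ => ⊥) (fun _ _ => 0) 0 (fun _ _ _ _ => le_rfl)
    (fun t₁ t₂ h0 => by
      rw [condExp_bot, h.integral_inner_winExp_eq_zero (hc t₁ t₂ h0), h.winExp_zero]
      simp) (β := fun q => martConst (M / 2) * (δ q * (ENNReal.ofReal √d *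
        (martConst M * ∑' j, δ j)) * ENNReal.ofReal
          √(∑ t₁ ∈ Finset.Icc (1 : ℤ) T, ∑ t₂ ∈ Finset.Icc (1 : ℤ) T, c t₁ t₂ ^ 2)))
    (fun q => by simpa using h.eLpNorm_sum_incr_winExp_le c T q n hc)
  simp only [condExp_bot] at key
  rw [ENNReal.tsum_mul_left, ENNReal.tsum_mul_right, ENNReal.tsum_mul_right] at key
  exact key

/-- `X t₁` ignores innovations after `t₁`; of the window at `t₂` there remain `t₁ - t₂ + m`
innovations, or none when this is negative. -/
theorem condExp_window_eq (h : CausalProcess μ M e X δ) {t₁ t₂ : ℤ} (ht : t₁ ≤ t₂) (m : ℕ) :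
    μ[X t₁ | sigmaOn e (Set.Ioc (t₂ - m) t₂)] =ᵐ[μ] winExp μ e X (t₁ - t₂ + m).toNat t₁ := by
  have e1 : Set.Ioc (t₂ - (m : ℤ)) t₂ ∩ Set.Iic t₁ =
      Set.Ioc (t₁ - ((t₁ - t₂ + m).toNat : ℤ)) t₁ := by
    ext x
    simp only [Set.mem_inter_iff, Set.mem_Ioc, Set.mem_Iic]
    omega
  rw [winExp, ← e1]
  exact h.condExp_eq _ t₁

/-- The coefficients with lag `t₂ - t₁` in `[l + 1 - q, l]`. -/
def nearCoef (c : ℤ → ℤ → ℝ) (l q : ℕ) (t₁ t₂ : ℤ) : ℝ :=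
  if (l : ℤ) + 1 - q ≤ t₂ - t₁ ∧ t₂ - t₁ ≤ l then c t₁ t₂ else 0

/-- The coefficients with lag `t₂ - t₁` larger than `l`. -/
def farCoef (c : ℤ → ℤ → ℝ) (l : ℕ) (t₁ t₂ : ℤ) : ℝ :=
  if (l : ℤ) + 1 ≤ t₂ - t₁ then c t₁ t₂ else 0

/-- The square root of the sum of the squared coefficients. -/
def coefNorm (c : ℤ → ℤ → ℝ) (T : ℕ) : ℝ :=
  √(∑ t₁ ∈ Finset.Icc (1 : ℤ) T, ∑ t₂ ∈ Finset.Icc (1 : ℤ) T, c t₁ t₂ ^ 2)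

/-- Moment bound for the error of replacing products by their conditional expectations given the
last `l + 1` innovations, for coefficients that vanish unless `t₂ - t₁ ≥ B`. -/
theorem eLpNorm_upper_truncError_le (h : CausalProcess μ M e X δ) {c : ℤ → ℤ → ℝ} {T B l : ℕ}
    (hBl : B ≤ l)
    (hc1 : ∀ t₁ ∈ Finset.Icc (1 : ℤ) T, ∀ t₂ ∈ Finset.Icc (1 : ℤ) T, |c t₁ t₂| ≤ 1)
    (hc : ∀ t₁ t₂, c t₁ t₂ ≠ 0 → (B : ℤ) ≤ t₂ - t₁) :
    eLpNorm (fun ω => ∑ t₁ ∈ Finset.Icc (1 : ℤ) T, ∑ t₂ ∈ Finset.Icc (1 : ℤ) T,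
      c t₁ t₂ * (inner ℝ (X t₁ ω) (X t₂ ω) -
        (μ[fun ω' => (inner ℝ (X t₁ ω') (X t₂ ω') : ℝ) |
          sigmaOn e (Set.Ioc (t₂ - (l + 1 : ℕ)) t₂)]) ω)) (ENNReal.ofReal (M / 2)) μ
      ≤ ∑' q, (martConst (M / 2) * (δ q * (ENNReal.ofReal √d * (martConst M * ∑' j, δ j)) *
            ENNReal.ofReal (coefNorm (farCoef c l) T))
          + martConst (M / 2) * (δ q * (ENNReal.ofReal √d * (martConst M * ∑' j, δ j)) *
            ENNReal.ofReal (coefNorm (nearCoef c l q) T))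
          + martConst (M / 2) * (ENNReal.ofReal √d * δ q *
            (ENNReal.ofReal √d * (martConst M * ∑' j, δ (B + j))) *
            ENNReal.ofReal (coefNorm (nearCoef c l q) T)))
        + 2 * ((ENNReal.ofReal √d * (martConst M * ∑' j, δ j)) *
        (ENNReal.ofReal √d * (martConst M * ∑' j, δ (l + 1 + j)))) * ENNReal.ofReal (T * √T) := by
  have hM := h.four_lt
  refine h.eLpNorm_centered_le (l + 1) hc1 (fun t₂ => sigmaOn e (Set.Ioc (t₂ - (l + 1 : ℕ)) t₂))
    (fun t₁ t₂ => (t₁ - t₂ + (l + 1 : ℕ)).toNat) (T + (l + 1)) (fun t₁ ht₁ t₂ ht₂ => ?_)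
    (fun t₁ t₂ h0 => ?_) (fun q => ?_)
  · simp only [Finset.mem_Icc] at *
    omega
  · have := hc t₁ t₂ h0
    refine (condExp_inner_of_right (M := M) (by linarith) (h.memLp t₁)
      (h.memLp_winExp (l + 1) t₂)
      (stronglyMeasurable_winExp (l + 1) t₂).aestronglyMeasurable).trans ?_
    filter_upwards [h.condExp_window_eq (t₁ := t₁) (t₂ := t₂) (by omega) (l + 1)] with ω k
    rw [k]
  -- The condition `k t₁ t₂ ≤ q` means a lag of at least `l + 1 - q` or beyond `l`. In the far range
  -- the window at `t₂` misses `t₁`. In the near range it is cut at length `B`: the recent piece is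
  -- independent of the increment, the older one has a small norm.
  · have hfar := h.eLpNorm_sum_incr_winExp_le (farCoef c l) T q (l + 1) (fun t₁ t₂ h0 => by
      simp only [farCoef, ne_eq, ite_eq_right_iff, Classical.not_imp] at h0
      have := h0.1
      omega)
    have hnear := h.eLpNorm_sum_incr_winExp_le (nearCoef c l q) T q B (fun t₁ t₂ h0 => by
      simp only [nearCoef, ne_eq, ite_eq_right_iff, Classical.not_imp] at h0
      exact hc t₁ t₂ h0.2)
    have hincr := h.eLpNorm_sum_incr_winIncr_le (nearCoef c l q) T q (n := B) (m := l + 1)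
      (by omega) (fun t₁ t₂ h0 => by
        simp only [nearCoef, ne_eq, ite_eq_right_iff, Classical.not_imp] at h0
        have := h0.1
        omega)
    set F : (ℤ → ℤ → ℝ) → (ℤ → Ω → EuclideanSpace ℝ (Fin d)) → Ω → ℝ := fun c' Z ω =>
      ∑ t₁ ∈ Finset.Icc (1 : ℤ) T, inner ℝ (winIncr μ e X q (q + 1) t₁ ω)
        (∑ t₂ ∈ Finset.Icc (1 : ℤ) T, c' t₁ t₂ • Z t₂ ω) with hF
    have hFm : ∀ c' (Z : ℤ → Ω → EuclideanSpace ℝ (Fin d)),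
        (∀ t, MemLp (Z t) (ENNReal.ofReal M) μ) → AEStronglyMeasurable (F c' Z) μ :=
      fun c' Z hZ => Finset.aestronglyMeasurable_fun_sum _ fun t₁ _ =>
        (h.memLp_winIncr q (q + 1) t₁).1.inner
          (Finset.aestronglyMeasurable_fun_sum _ fun t₂ _ => (hZ t₂).1.const_smul (c' t₁ t₂))
    have hsum : F (fun t₁ t₂ => if (t₁ - t₂ + (l + 1 : ℕ)).toNat ≤ q then c t₁ t₂ else 0)
        (winExp μ e X (l + 1)) = F (farCoef c l) (winExp μ e X (l + 1)) +
          F (nearCoef c l q) (winExp μ e X B) +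
          F (nearCoef c l q) (winIncr μ e X B (l + 1)) := by
      funext ω
      simp only [hF, Pi.add_apply, ← Finset.sum_add_distrib, ← inner_add_right]
      refine Finset.sum_congr rfl fun t₁ _ => ?_
      congr 1
      refine Finset.sum_congr rfl fun t₂ _ => ?_
      rw [add_assoc, ← smul_add]
      have e1 : winExp μ e X B t₂ ω + winIncr μ e X B (l + 1) t₂ ω
          = winExp μ e X (l + 1) t₂ ω := by simp [winIncr]
      rw [e1, ← add_smul]
      congr 1
      simp only [farCoef, nearCoef]
      split_ifs <;> first | omega | simp
    have m1 := hFm (farCoef c l) (winExp μ e X (l + 1)) (h.memLp_winExp (l + 1))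
    have m2 := hFm (nearCoef c l q) (winExp μ e X B) (h.memLp_winExp B)
    have m3 := hFm (nearCoef c l q) (winIncr μ e X B (l + 1)) (h.memLp_winIncr B (l + 1))
    change eLpNorm (F (fun t₁ t₂ => if (t₁ - t₂ + (l + 1 : ℕ)).toNat ≤ q then c t₁ t₂ else 0)
        (winExp μ e X (l + 1))) _ μ ≤ _
    rw [hsum]
    exact (eLpNorm_add_le (m1.add m2) m3 h.one_le_half).trans (add_le_add
      ((eLpNorm_add_le m1 m2 h.one_le_half).trans (add_le_add hfar hnear)) hincr)

end CausalProcess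

/-! ### Splitting into triangles and estimating coefficient sums. -/

/-- Both `e_t` and `e_{t-l}` belong to the window, so its length is `l + 1`. -/
theorem innovSigma_eq_sigmaOn {Ω S : Type*} [MeasurableSpace S] (e : ℤ → Ω → S) (t : ℤ) (l : ℕ) :
    innovSigma e t l = sigmaOn e (Set.Ioc (t - (l + 1 : ℕ)) t) := by
  apply le_antisymm
  · refine iSup₂_le fun j hj => le_iSup₂_of_le (t - j) ?_ le_rfl
    simp only [Set.mem_Ioc]
    omega
  · refine iSup₂_le fun i hi => ?_
    simp only [Set.mem_Ioc] at hi
    have hi' : e i = e (t - (t - i).toNat) := by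
      congr 1
      omega
    rw [hi']
    exact le_iSup₂_of_le (f := fun (j : ℕ) (_ : j ≤ l) => MeasurableSpace.comap (e (t - j)) _)
      (t - i).toNat (by omega) le_rfl

/-- The coefficients with lag `t₂ - t₁` at least `B`. -/
def upperCoef (b : ℤ → ℤ → ℝ) (B : ℕ) (t₁ t₂ : ℤ) : ℝ :=
  if (B : ℤ) ≤ t₂ - t₁ then b t₁ t₂ else 0

theorem le_of_upperCoef_ne_zero {b : ℤ → ℤ → ℝ} {B : ℕ} {t₁ t₂ : ℤ}
    (h : upperCoef b B t₁ t₂ ≠ 0) : (B : ℤ) ≤ t₂ - t₁ := by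
  by_contra h'
  exact h (if_neg h')

theorem abs_upperCoef_le {b : ℤ → ℤ → ℝ} {T : ℕ} (B : ℕ)
    (hb : ∀ t₁ ∈ Finset.Icc (1 : ℤ) T, ∀ t₂ ∈ Finset.Icc (1 : ℤ) T, |b t₁ t₂| ≤ 1) :
    ∀ t₁ ∈ Finset.Icc (1 : ℤ) T, ∀ t₂ ∈ Finset.Icc (1 : ℤ) T, |upperCoef b B t₁ t₂| ≤ 1 := by
  intro t₁ h₁ t₂ h₂
  unfold upperCoef
  split_ifs
  · exact hb t₁ h₁ t₂ h₂
  · simp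

/-- A banded double sum against a symmetric kernel splits into its two triangular parts. -/
theorem sum_eq_sum_upperCoef_add {b : ℤ → ℤ → ℝ} {B T : ℕ} (hB : 0 < B)
    (hb : ∀ t₁ ∈ Finset.Icc (1 : ℤ) T, ∀ t₂ ∈ Finset.Icc (1 : ℤ) T,
      |t₁ - t₂| < (B : ℤ) → b t₁ t₂ = 0) {I : ℤ → ℤ → ℝ} (hI : ∀ t₁ t₂, I t₁ t₂ = I t₂ t₁) :
    ∑ t₁ ∈ Finset.Icc (1 : ℤ) T, ∑ t₂ ∈ Finset.Icc (1 : ℤ) T, b t₁ t₂ * I t₁ t₂ =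
      ∑ t₁ ∈ Finset.Icc (1 : ℤ) T, ∑ t₂ ∈ Finset.Icc (1 : ℤ) T, upperCoef b B t₁ t₂ * I t₁ t₂ +
      ∑ t₁ ∈ Finset.Icc (1 : ℤ) T, ∑ t₂ ∈ Finset.Icc (1 : ℤ) T,
        upperCoef (fun s t => b t s) B t₁ t₂ * I t₁ t₂ := by
  rw [Finset.sum_comm (f := fun t₁ t₂ => upperCoef (fun s t => b t s) B t₁ t₂ * I t₁ t₂),
    ← Finset.sum_add_distrib]
  refine Finset.sum_congr rfl fun t₁ h₁ => ?_
  rw [← Finset.sum_add_distrib]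
  refine Finset.sum_congr rfl fun t₂ h₂ => ?_
  rw [hI t₂ t₁, ← add_mul]
  congr 1
  simp only [upperCoef]
  -- For `B > 0` the two triangles are disjoint, so the first case is contradictory; the last one is
  -- the band where `b` vanishes.
  split_ifs with h3 h4 h4
  · omega
  · simp
  · simp
  · rw [hb t₁ h₁ t₂ h₂ (abs_lt.2 ⟨by omega, by omega⟩), add_zero]

theorem sumSqLag_swap (b : ℤ → ℤ → ℝ) (T : ℕ) (P : ℤ → Prop) [DecidablePred P] :
    sumSqLag (fun s t => b t s) T P = sumSqLag b T P := by
  unfold sumSqLag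
  rw [Finset.sum_comm]
  simp only [abs_sub_comm]

theorem sum_sq_upperCoef_le (b : ℤ → ℤ → ℝ) (B T : ℕ) :
    ∑ t₁ ∈ Finset.Icc (1 : ℤ) T, ∑ t₂ ∈ Finset.Icc (1 : ℤ) T, upperCoef b B t₁ t₂ ^ 2 ≤
      ∑ t₁ ∈ Finset.Icc (1 : ℤ) T, ∑ t₂ ∈ Finset.Icc (1 : ℤ) T, b t₁ t₂ ^ 2 := by
  refine Finset.sum_le_sum fun t₁ _ => Finset.sum_le_sum fun t₂ _ => ?_
  unfold upperCoef
  split_ifs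
  · exact le_rfl
  · simpa using sq_nonneg (b t₁ t₂)

open CausalProcess in
theorem coefNorm_farCoef_le (b : ℤ → ℤ → ℝ) (B T l : ℕ) :
    coefNorm (farCoef (upperCoef b B) l) T ≤ √(sumSqLag b T (fun k => (l : ℤ) + 1 ≤ k)) := by
  refine Real.sqrt_le_sqrt (Finset.sum_le_sum fun t₁ _ => Finset.sum_le_sum fun t₂ _ => ?_)
  simp only [farCoef, upperCoef]
  have : |t₁ - t₂| = |t₂ - t₁| := abs_sub_comm _ _
  have h2 := le_abs_self (t₂ - t₁)
  have := sq_nonneg (b t₁ t₂)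
  split_ifs <;> first | omega | simp [this]

open CausalProcess in
theorem coefNorm_nearCoef_le (b : ℤ → ℤ → ℝ) (B T l q : ℕ) :
    coefNorm (nearCoef (upperCoef b B) l q) T ≤
      √(sumSqLag b T (fun k => max (B : ℤ) (l + 1 - q) ≤ k ∧ k ≤ l)) := by
  refine Real.sqrt_le_sqrt (Finset.sum_le_sum fun t₁ _ => Finset.sum_le_sum fun t₂ _ => ?_)
  simp only [nearCoef, upperCoef]
  have h0 := sq_nonneg (b t₁ t₂)
  by_cases h1 : (l : ℤ) + 1 - q ≤ t₂ - t₁ ∧ t₂ - t₁ ≤ l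
  · by_cases h2 : (B : ℤ) ≤ t₂ - t₁
    · have h3 : |t₁ - t₂| = t₂ - t₁ := by
        rw [abs_sub_comm]
        exact abs_of_nonneg (by omega)
      rw [if_pos h1, if_pos h2, if_pos (by rw [h3]; exact ⟨max_le h2 h1.1, h1.2⟩)]
    · rw [if_pos h1, if_neg h2]
      split_ifs <;> simp [h0]
  · rw [if_neg h1]
    split_ifs <;> simp [h0]

-- For `q = 0` the band `[l + 1, l]` is empty; this lets the series start at `q = 1`.
open CausalProcess in
theorem coefNorm_nearCoef_zero (c : ℤ → ℤ → ℝ) (T l : ℕ) : coefNorm (nearCoef c l 0) T = 0 := by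
  have : nearCoef c l 0 = fun _ _ => 0 := by
    funext t₁ t₂
    exact if_neg (by push_cast; omega)
  simp [coefNorm, this]

-- Each row has at most `q` nonzero entries, of modulus at most `1`.
open CausalProcess in
theorem coefNorm_nearCoef_le_sqrt {c : ℤ → ℤ → ℝ} {T : ℕ} (l q : ℕ)
    (hc : ∀ t₁ ∈ Finset.Icc (1 : ℤ) T, ∀ t₂ ∈ Finset.Icc (1 : ℤ) T, |c t₁ t₂| ≤ 1) :
    coefNorm (nearCoef c l q) T ≤ √T * √q := by
  rw [← Real.sqrt_mul (Nat.cast_nonneg T)]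
  refine Real.sqrt_le_sqrt ?_
  calc ∑ t₁ ∈ Finset.Icc (1 : ℤ) T, ∑ t₂ ∈ Finset.Icc (1 : ℤ) T, nearCoef c l q t₁ t₂ ^ 2
      ≤ ∑ t₁ ∈ Finset.Icc (1 : ℤ) T, (q : ℝ) := by
        refine Finset.sum_le_sum fun t₁ h₁ => ?_
        calc ∑ t₂ ∈ Finset.Icc (1 : ℤ) T, nearCoef c l q t₁ t₂ ^ 2
            ≤ ∑ t₂ ∈ Finset.Icc (1 : ℤ) T,
                if t₂ ∈ Finset.Icc (t₁ + l + 1 - q) (t₁ + l) then (1 : ℝ) else 0 := by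
              refine Finset.sum_le_sum fun t₂ h₂ => ?_
              unfold nearCoef
              by_cases h3 : (l : ℤ) + 1 - q ≤ t₂ - t₁ ∧ t₂ - t₁ ≤ l
              · rw [if_pos h3, if_pos (Finset.mem_Icc.2 ⟨by omega, by omega⟩)]
                exact (sq_le_one_iff_abs_le_one _).2 (hc t₁ h₁ t₂ h₂)
              · rw [if_neg h3]
                split_ifs <;> simp
          _ = ((Finset.Icc (1 : ℤ) T ∩ Finset.Icc (t₁ + l + 1 - q) (t₁ + l)).card : ℝ) := by
              rw [← Finset.sum_filter, Finset.filter_mem_eq_inter]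
              simp
          _ ≤ q := by
              have h4 := Finset.card_le_card (Finset.inter_subset_right
                (s₁ := Finset.Icc (1 : ℤ) T) (s₂ := Finset.Icc (t₁ + l + 1 - q) (t₁ + l)))
              rw [Int.card_Icc] at h4
              have h5 : (t₁ + l + 1 - (t₁ + l + 1 - q)).toNat = q := by omega
              rw [h5] at h4
              exact_mod_cast h4
    _ = T * q := by simp

/-! ### Explicit bounds from the polynomial tail of `δ`. -/

namespace CausalProcess

variable {Ω S : Type*} {m0 : MeasurableSpace Ω} [MeasurableSpace S] {μ : Measure Ω}
  [IsProbabilityMeasure μ] {M : ℝ} {e : ℤ → Ω → S} {d : ℕ}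
  {X : ℤ → Ω → EuclideanSpace ℝ (Fin d)} {δ : ℕ → ℝ≥0∞}

theorem remainder_le_ofReal {K α : ℝ} (hK : 0 ≤ K)
    (hδ : ∀ s : ℕ, ∑' j, δ (s + j) ≤ ENNReal.ofReal (K * (1 + s : ℝ) ^ (-α))) (n T : ℕ) :
    2 * ((ENNReal.ofReal √d * (martConst M * ∑' j, δ j)) *
        (ENNReal.ofReal √d * (martConst M * ∑' j, δ (n + j)))) * ENNReal.ofReal (T * √T)
      ≤ ENNReal.ofReal (2 * (martConst M : ℝ) ^ 2 * K ^ 2 *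
        (d * (T * √T) * (1 + n : ℝ) ^ (-α))) := by
  have h0 : ∑' j, δ j ≤ ENNReal.ofReal K := by simpa using hδ 0
  have hw : 0 ≤ (1 + n : ℝ) ^ (-α) := by positivity
  calc _ ≤ ENNReal.ofReal 2 * ((ENNReal.ofReal √d * (ENNReal.ofReal (martConst M) *
          ENNReal.ofReal K)) * (ENNReal.ofReal √d * (ENNReal.ofReal (martConst M) *
          ENNReal.ofReal (K * (1 + n : ℝ) ^ (-α))))) * ENNReal.ofReal (T * √T) := by
        rw [ENNReal.ofReal_coe_nnreal, ENNReal.ofReal_ofNat]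
        gcongr
        exact hδ n
    _ = _ := by
        rw [← ENNReal.ofReal_mul (by positivity), ← ENNReal.ofReal_mul (by positivity),
          ← ENNReal.ofReal_mul (by positivity), ← ENNReal.ofReal_mul (by positivity),
          ← ENNReal.ofReal_mul (by positivity), ← ENNReal.ofReal_mul (by positivity),
          ← ENNReal.ofReal_mul (by positivity)]
        congr 1
        have : √(d : ℝ) * √d = d := Real.mul_self_sqrt (Nat.cast_nonneg d)
        linear_combination (2 * (martConst M : ℝ) ^ 2 * K ^ 2 * (T * √T) *
          (1 + n : ℝ) ^ (-α)) * this

theorem main_le_ofReal {K r : ℝ} (hK : 0 ≤ K)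
    (h0 : ∑' j, δ j ≤ ENNReal.ofReal K) {ρ : ℝ} (hρ : √d * ρ ≤ r) :
    martConst (M / 2) * ((∑' j, δ j) * (ENNReal.ofReal √d * (martConst M * ∑' j, δ j)) *
        ENNReal.ofReal ρ)
      ≤ ENNReal.ofReal ((martConst (M / 2) * martConst M : ℝ) * K ^ 2 * r) := by
  calc _ = (martConst (M / 2) * martConst M : ℝ≥0∞) * (∑' j, δ j) ^ 2 *
          ENNReal.ofReal (√d * ρ) := by
        rw [ENNReal.ofReal_mul (Real.sqrt_nonneg _)]
        ring
    _ ≤ (ENNReal.ofReal (martConst (M / 2)) * ENNReal.ofReal (martConst M)) *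
          ENNReal.ofReal K ^ 2 * ENNReal.ofReal r := by
        rw [ENNReal.ofReal_coe_nnreal, ENNReal.ofReal_coe_nnreal]
        gcongr
    _ = _ := by
        rw [← ENNReal.ofReal_pow hK, ← ENNReal.ofReal_mul (by positivity),
          ← ENNReal.ofReal_mul (by positivity), ← ENNReal.ofReal_mul (by positivity)]

theorem eLpNorm_quadForm_upperCoef_le (h : CausalProcess μ M e X δ) {K α : ℝ} (hK : 0 ≤ K)
    (hδ : ∀ s : ℕ, ∑' j, δ (s + j) ≤ ENNReal.ofReal (K * (1 + s : ℝ) ^ (-α)))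
    {b : ℤ → ℤ → ℝ} {T : ℕ} (B : ℕ)
    (hb : ∀ t₁ ∈ Finset.Icc (1 : ℤ) T, ∀ t₂ ∈ Finset.Icc (1 : ℤ) T, |b t₁ t₂| ≤ 1) :
    eLpNorm (quadForm μ X (upperCoef b B) T) (ENNReal.ofReal (M / 2)) μ ≤
      ENNReal.ofReal ((martConst (M / 2) * martConst M : ℝ) * K ^ 2 *
        √(d * ∑ t₁ ∈ Finset.Icc (1 : ℤ) T, ∑ t₂ ∈ Finset.Icc (1 : ℤ) T, b t₁ t₂ ^ 2)
        + 2 * (martConst M : ℝ) ^ 2 * K ^ 2 * (d * (T * √T) * (1 + B : ℝ) ^ (-α))) := by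
  have h0 : ∑' j, δ j ≤ ENNReal.ofReal K := by simpa using hδ 0
  rw [ENNReal.ofReal_add (by positivity) (by positivity)]
  refine (h.eLpNorm_upper_quadForm_le B (abs_upperCoef_le B hb)
    fun _ _ => le_of_upperCoef_ne_zero).trans (add_le_add ?_ (remainder_le_ofReal hK hδ B T))
  refine main_le_ofReal hK h0 ?_
  rw [← Real.sqrt_mul (Nat.cast_nonneg d)]
  exact Real.sqrt_le_sqrt
    (mul_le_mul_of_nonneg_left (sum_sq_upperCoef_le b B T) (Nat.cast_nonneg d))

end CausalProcess

theorem summable_one_div_one_add_sq : Summable fun q : ℕ => 1 / (1 + q : ℝ) ^ 2 := by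
  have := (summable_nat_add_iff 1).2 (Real.summable_one_div_nat_pow.2 (one_lt_two))
  refine this.congr fun q => ?_
  push_cast
  rw [add_comm]

/-- Bounding `δ q` by its tail sum, this makes `∑ δ q * √q` converge with a numerical constant. -/
theorem rpow_neg_mul_sqrt_le {α : ℝ} (hα : 4 < α) (q : ℕ) :
    (1 + q : ℝ) ^ (-α) * √q ≤ 1 / (1 + q : ℝ) ^ 2 := by
  have h1 : (1 : ℝ) ≤ 1 + q := by simp
  have h0 : (0 : ℝ) < 1 + q := by linarith
  have h2 : √(q : ℝ) ≤ 1 + q := by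
    rw [Real.sqrt_le_left h0.le]
    nlinarith [(Nat.cast_nonneg q : (0 : ℝ) ≤ q)]
  have h3 : (1 + q : ℝ) ^ (-α) ≤ (1 + q : ℝ) ^ (-3 : ℝ) :=
    Real.rpow_le_rpow_of_exponent_le h1 (by linarith)
  calc (1 + q : ℝ) ^ (-α) * √q ≤ (1 + q : ℝ) ^ (-3 : ℝ) * (1 + q) := by gcongr
    _ = _ := by
      rw [Real.rpow_neg h0.le, show (3 : ℝ) = ((3 : ℕ) : ℝ) by norm_num, Real.rpow_natCast]
      field_simp

theorem tsum_eq_tsum_pos {f : ℕ → ℝ≥0∞} (h0 : f 0 = 0) :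
    ∑' q, f q = ∑' q : {q : ℕ // 1 ≤ q}, f q := by
  refine (tsum_subtype_eq_of_support_subset (f := f) (s := {q : ℕ | 1 ≤ q}) fun q hq => ?_).symm
  by_contra h
  have : q = 0 := by
    simp only [Set.mem_ofPred_eq] at h
    omega
  exact hq (this ▸ h0)

namespace CausalProcess

variable {Ω S : Type*} {m0 : MeasurableSpace Ω} [MeasurableSpace S] {μ : Measure Ω}
  [IsProbabilityMeasure μ] {M : ℝ} {e : ℤ → Ω → S} {d : ℕ}
  {X : ℤ → Ω → EuclideanSpace ℝ (Fin d)} {δ : ℕ → ℝ≥0∞}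

theorem tsum_near_le {K : ℝ} (h0 : ∑' j, δ j ≤ ENNReal.ofReal K) (b : ℤ → ℤ → ℝ) (T B l : ℕ) :
    ∑' q, martConst (M / 2) * (δ q * (ENNReal.ofReal √d * (martConst M * ∑' j, δ j)) *
        ENNReal.ofReal (coefNorm (nearCoef (upperCoef b B) l q) T))
      ≤ ENNReal.ofReal ((martConst (M / 2) * martConst M : ℝ) * K) *
        ∑' q : {q : ℕ // 1 ≤ q}, δ q * ENNReal.ofReal √(d * sumSqLag b T
          (fun k => max (B : ℤ) (l + 1 - (q : ℕ)) ≤ k ∧ k ≤ l)) := by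
  have e1 : ∀ q, martConst (M / 2) * (δ q * (ENNReal.ofReal √d * (martConst M * ∑' j, δ j)) *
        ENNReal.ofReal (coefNorm (nearCoef (upperCoef b B) l q) T)) =
      (martConst (M / 2) * martConst M * ∑' j, δ j) * (δ q * (ENNReal.ofReal √d *
        ENNReal.ofReal (coefNorm (nearCoef (upperCoef b B) l q) T))) := fun q => by ring
  simp_rw [e1]
  rw [ENNReal.tsum_mul_left, tsum_eq_tsum_pos (f := fun q => δ q * (ENNReal.ofReal √d *
    ENNReal.ofReal (coefNorm (nearCoef (upperCoef b B) l q) T)))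
    (by simp only [coefNorm_nearCoef_zero]; simp)]
  refine mul_le_mul' ?_ (ENNReal.tsum_le_tsum fun q => mul_le_mul' le_rfl ?_)
  · rw [ENNReal.ofReal_mul (by positivity), ENNReal.ofReal_mul (by positivity),
      ENNReal.ofReal_coe_nnreal, ENNReal.ofReal_coe_nnreal]
    gcongr
  · rw [← ENNReal.ofReal_mul (Real.sqrt_nonneg _), Real.sqrt_mul (Nat.cast_nonneg d)]
    exact ENNReal.ofReal_le_ofReal
      (mul_le_mul_of_nonneg_left (coefNorm_nearCoef_le b B T l q) (Real.sqrt_nonneg _))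

theorem tsum_incr_le {K α : ℝ} (hK : 0 ≤ K) (hα : 4 < α)
    (hδ : ∀ s : ℕ, ∑' j, δ (s + j) ≤ ENNReal.ofReal (K * (1 + s : ℝ) ^ (-α)))
    {c : ℤ → ℤ → ℝ} {T : ℕ} (B l : ℕ)
    (hc : ∀ t₁ ∈ Finset.Icc (1 : ℤ) T, ∀ t₂ ∈ Finset.Icc (1 : ℤ) T, |c t₁ t₂| ≤ 1) :
    ∑' q, martConst (M / 2) * (ENNReal.ofReal √d * δ q *
        (ENNReal.ofReal √d * (martConst M * ∑' j, δ (B + j))) *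
        ENNReal.ofReal (coefNorm (nearCoef c l q) T))
      ≤ ENNReal.ofReal ((martConst (M / 2) * martConst M : ℝ) * K ^ 2 *
        (∑' q : ℕ, 1 / (1 + q : ℝ) ^ 2) * (d * √T * (1 + B : ℝ) ^ (-α))) := by
  have hterm : ∀ q, martConst (M / 2) * (ENNReal.ofReal √d * δ q *
        (ENNReal.ofReal √d * (martConst M * ∑' j, δ (B + j))) *
        ENNReal.ofReal (coefNorm (nearCoef c l q) T)) ≤
      ENNReal.ofReal ((martConst (M / 2) * martConst M : ℝ) * K ^ 2 *
        (d * √T * (1 + B : ℝ) ^ (-α))) * ENNReal.ofReal (1 / (1 + q : ℝ) ^ 2) := by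
    intro q
    have hq : δ q ≤ ENNReal.ofReal (K * (1 + q : ℝ) ^ (-α)) :=
      (by simpa using ENNReal.le_tsum (f := fun j => δ (q + j)) 0 : δ q ≤ _).trans (hδ q)
    calc _ ≤ ENNReal.ofReal (martConst (M / 2)) * (ENNReal.ofReal √d *
            ENNReal.ofReal (K * (1 + q : ℝ) ^ (-α)) * (ENNReal.ofReal √d *
            (ENNReal.ofReal (martConst M) * ENNReal.ofReal (K * (1 + B : ℝ) ^ (-α)))) *
            ENNReal.ofReal (√T * √q)) := by
          rw [ENNReal.ofReal_coe_nnreal, ENNReal.ofReal_coe_nnreal]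
          gcongr
          · exact hδ B
          · exact coefNorm_nearCoef_le_sqrt l q hc
      _ = ENNReal.ofReal ((martConst (M / 2) * martConst M : ℝ) * K ^ 2 *
            (d * √T * (1 + B : ℝ) ^ (-α)) * ((1 + q : ℝ) ^ (-α) * √q)) := by
          rw [← ENNReal.ofReal_mul (by positivity), ← ENNReal.ofReal_mul (by positivity),
            ← ENNReal.ofReal_mul (by positivity), ← ENNReal.ofReal_mul (by positivity),
            ← ENNReal.ofReal_mul (by positivity), ← ENNReal.ofReal_mul (by positivity)]
          congr 1
          have : √(d : ℝ) * √d = d := Real.mul_self_sqrt (Nat.cast_nonneg d)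
          linear_combination ((martConst (M / 2) * martConst M : ℝ) * K ^ 2 *
            (√T * (1 + B : ℝ) ^ (-α)) * ((1 + q : ℝ) ^ (-α) * √q)) * this
      _ ≤ _ := by
          rw [← ENNReal.ofReal_mul (by positivity)]
          exact ENNReal.ofReal_le_ofReal
            (mul_le_mul_of_nonneg_left (rpow_neg_mul_sqrt_le hα q) (by positivity))
  refine (ENNReal.tsum_le_tsum hterm).trans ?_
  rw [ENNReal.tsum_mul_left, ← ENNReal.ofReal_tsum_of_nonneg (fun q => by positivity)
    summable_one_div_one_add_sq, ← ENNReal.ofReal_mul (by positivity)]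
  refine ENNReal.ofReal_le_ofReal (le_of_eq ?_)
  ring

theorem eLpNorm_truncError_upperCoef_le (h : CausalProcess μ M e X δ) {K α : ℝ} (hK : 0 ≤ K)
    (hα : 4 < α)
    (hδ : ∀ s : ℕ, ∑' j, δ (s + j) ≤ ENNReal.ofReal (K * (1 + s : ℝ) ^ (-α)))
    {b : ℤ → ℤ → ℝ} {T B l : ℕ} (hBl : B ≤ l)
    (hb : ∀ t₁ ∈ Finset.Icc (1 : ℤ) T, ∀ t₂ ∈ Finset.Icc (1 : ℤ) T, |b t₁ t₂| ≤ 1) :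
    eLpNorm (quadFormTruncError μ e X (upperCoef b B) T l) (ENNReal.ofReal (M / 2)) μ ≤
      ENNReal.ofReal ((martConst (M / 2) * martConst M : ℝ) * K) *
        ∑' q : {q : ℕ // 1 ≤ q}, δ q * ENNReal.ofReal √(d * sumSqLag b T
          (fun k => max (B : ℤ) (l + 1 - (q : ℕ)) ≤ k ∧ k ≤ l))
      + ENNReal.ofReal ((martConst (M / 2) * martConst M : ℝ) * K ^ 2 *
          √(d * sumSqLag b T (fun k => (l : ℤ) + 1 ≤ k))
        + (martConst (M / 2) * martConst M : ℝ) * K ^ 2 *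
          (∑' q : ℕ, 1 / (1 + q : ℝ) ^ 2) * (d * √T * (1 + B : ℝ) ^ (-α))
        + 2 * (martConst M : ℝ) ^ 2 * K ^ 2 *
          (d * (T * √T) * (1 + (l + 1 : ℕ) : ℝ) ^ (-α))) := by
  have h0 : ∑' j, δ j ≤ ENNReal.ofReal K := by simpa using hδ 0
  have hZ : 0 ≤ ∑' q : ℕ, 1 / (1 + q : ℝ) ^ 2 := tsum_nonneg fun q => by positivity
  have hfun : quadFormTruncError μ e X (upperCoef b B) T l =
      fun ω => ∑ t₁ ∈ Finset.Icc (1 : ℤ) T, ∑ t₂ ∈ Finset.Icc (1 : ℤ) T,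
      upperCoef b B t₁ t₂ * (inner ℝ (X t₁ ω) (X t₂ ω) -
        (μ[fun ω' => (inner ℝ (X t₁ ω') (X t₂ ω') : ℝ) |
          sigmaOn e (Set.Ioc (t₂ - (l + 1 : ℕ)) t₂)]) ω) := by
    funext ω
    refine Finset.sum_congr rfl fun t₁ _ => Finset.sum_congr rfl fun t₂ _ => ?_
    by_cases hc : upperCoef b B t₁ t₂ = 0
    · simp [hc]
    · have := le_of_upperCoef_ne_zero hc
      rw [max_eq_right (by omega : t₁ ≤ t₂), innovSigma_eq_sigmaOn]
  rw [hfun]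
  refine (h.eLpNorm_upper_truncError_le hBl (abs_upperCoef_le B hb)
    fun _ _ => le_of_upperCoef_ne_zero).trans ?_
  rw [ENNReal.tsum_add, ENNReal.tsum_add, ENNReal.ofReal_add (by positivity) (by positivity),
    ENNReal.ofReal_add (by positivity) (by positivity), ← add_assoc, ← add_assoc]
  refine add_le_add (add_le_add ?_ (tsum_incr_le hK hα hδ B l (abs_upperCoef_le B hb)))
    (remainder_le_ofReal hK hδ (l + 1) T)
  rw [add_comm]
  refine add_le_add (tsum_near_le h0 b T B l) ?_
  rw [ENNReal.tsum_mul_left, ENNReal.tsum_mul_right, ENNReal.tsum_mul_right]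
  refine main_le_ofReal hK h0 ?_
  rw [Real.sqrt_mul (Nat.cast_nonneg d)]
  exact mul_le_mul_of_nonneg_left (coefNorm_farCoef_le b B T l) (Real.sqrt_nonneg _)

end CausalProcess

/-! ### Application to short-range dependent processes. -/

theorem causalProcess_proc {Ω S : Type*} [MeasurableSpace Ω] [MeasurableSpace S]
    {μ : Measure Ω} [IsProbabilityMeasure μ] {M α : ℝ} (hM : 4 < M) {e eDag : ℤ → Ω → S}
    {d : ℕ → ℕ} {g : (T : ℕ) → ℤ → (ℕ → S) → EuclideanSpace ℝ (Fin (d T))}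
    (h : IsShortRangeDependent μ M α e eDag d g) {T : ℕ} (hT : 1 ≤ T) :
    CausalProcess μ M e (proc e (g T)) (depDelta μ M e eDag (g T)) := by
  have hinn := h.innovations
  have hg := h.measurable_g T hT
  have hadapt : ∀ t, StronglyMeasurable[sigmaOn e (Set.Iic t)] (proc e (g T) t) := fun t =>
    ((hg t).comp (measurable_pastSeq fun s hs =>
      measurable_sigmaOn (Set.mem_Iic.2 hs))).stronglyMeasurable
  -- The moment bound serves only for integrability; the constants of the theorem come from the
  -- dependence bound and from `d ≍ T`.
  have hlp : ∀ t, MemLp (proc e (g T) t) (ENNReal.ofReal M) μ := fun t => by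
    obtain ⟨K, hK⟩ := h.moment_bound
    have hm : AEStronglyMeasurable (proc e (g T) t) μ :=
      ((hadapt t).mono (sigmaOn_le hinn.measurable_e _)).aestronglyMeasurable
    refine ⟨hm, (eLpNorm_le_sqrt_mul_of_inner_le (c := K) (by linarith) hm
      (eLpNorm_inner_le_of_unit fun a ha => ?_)).trans_lt
      (ENNReal.mul_lt_top ENNReal.ofReal_lt_top ENNReal.coe_lt_top)⟩
    refine le_trans ?_ (hK T hT)
    exact le_iSup₂_of_le t a (le_iSup_of_le ha le_rfl)
  exact
    { measurable_e := hinn.measurable_e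
      indep := hinn.indep.precomp (g := Sum.inl) Sum.inl_injective
      four_lt := hM
      adapted := hadapt
      memLp := hlp
      mean_zero := h.mean_zero T hT
      incr_le := fun q t a => eLpNorm_inner_condExp_sub_le hinn (by linarith) (hg t)
        ((hlp t).integrable (one_le_ofReal_of_le (by linarith))) q a }

theorem exists_tail_bound {Ω S : Type*} [MeasurableSpace Ω] [MeasurableSpace S]
    {μ : Measure Ω} {M α : ℝ} {e eDag : ℤ → Ω → S}
    {d : ℕ → ℕ} {g : (T : ℕ) → ℤ → (ℕ → S) → EuclideanSpace ℝ (Fin (d T))}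
    (h : IsShortRangeDependent μ M α e eDag d g) :
    ∃ K : ℝ, 0 ≤ K ∧ ∀ T, 1 ≤ T → ∀ s : ℕ, ∑' j, depDelta μ M e eDag (g T) (s + j) ≤
      ENNReal.ofReal (K * (1 + s : ℝ) ^ (-α)) := by
  obtain ⟨K, hK⟩ := h.dependence_bound
  refine ⟨K, K.coe_nonneg, fun T hT s => ?_⟩
  have h1 := (le_iSup (fun s : ℕ => ENNReal.ofReal ((1 + s : ℝ) ^ α) *
      ∑' j : ℕ, depDelta μ M e eDag (g T) (s + j)) s).trans (hK T hT)
  have hpos : (0 : ℝ) < (1 + s : ℝ) ^ α := by positivity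
  rw [Real.rpow_neg (by positivity), ENNReal.ofReal_mul K.coe_nonneg, ENNReal.ofReal_inv_of_pos hpos,
    ENNReal.ofReal_coe_nnreal, ← div_eq_mul_inv, ENNReal.le_div_iff_mul_le
      (Or.inl (by simpa using hpos)) (Or.inl ENNReal.ofReal_ne_top), mul_comm]
  exact h1

namespace CausalProcess

variable {Ω S : Type*} {m0 : MeasurableSpace Ω} [MeasurableSpace S] {μ : Measure Ω}
  {M : ℝ} {e : ℤ → Ω → S} {d : ℕ}
  {X : ℤ → Ω → EuclideanSpace ℝ (Fin d)} {δ : ℕ → ℝ≥0∞}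

theorem aestronglyMeasurable_quadForm (h : CausalProcess μ M e X δ) (b : ℤ → ℤ → ℝ) (T : ℕ) :
    AEStronglyMeasurable (quadForm μ X b T) μ :=
  Finset.aestronglyMeasurable_fun_sum _ fun t₁ _ => Finset.aestronglyMeasurable_fun_sum _
    fun t₂ _ => (((h.memLp t₁).1.inner (h.memLp t₂).1).sub
      aestronglyMeasurable_const).const_mul (b t₁ t₂)

theorem aestronglyMeasurable_quadFormTruncError (h : CausalProcess μ M e X δ) (b : ℤ → ℤ → ℝ)
    (T l : ℕ) : AEStronglyMeasurable (quadFormTruncError μ e X b T l) μ :=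
  Finset.aestronglyMeasurable_fun_sum _ fun t₁ _ => Finset.aestronglyMeasurable_fun_sum _
    fun t₂ _ => (((h.memLp t₁).1.inner (h.memLp t₂).1).sub
      integrable_condExp.1).const_mul (b t₁ t₂)

end CausalProcess

section Split

variable {Ω : Type*} [MeasurableSpace Ω] {d B T : ℕ} {b : ℤ → ℤ → ℝ}

theorem quadForm_eq_upperCoef_add (μ : Measure Ω) (X : ℤ → Ω → EuclideanSpace ℝ (Fin d))
    (hB : 0 < B) (hb : ∀ t₁ ∈ Finset.Icc (1 : ℤ) T, ∀ t₂ ∈ Finset.Icc (1 : ℤ) T,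
      |t₁ - t₂| < (B : ℤ) → b t₁ t₂ = 0) :
    quadForm μ X b T = quadForm μ X (upperCoef b B) T +
      quadForm μ X (upperCoef (fun s t => b t s) B) T := by
  funext ω
  exact sum_eq_sum_upperCoef_add hB hb fun t₁ t₂ => by simp only [real_inner_comm]

theorem quadFormTruncError_eq_upperCoef_add {S : Type*} [MeasurableSpace S] (μ : Measure Ω)
    (e : ℤ → Ω → S) (X : ℤ → Ω → EuclideanSpace ℝ (Fin d))
    (hB : 0 < B) (hb : ∀ t₁ ∈ Finset.Icc (1 : ℤ) T, ∀ t₂ ∈ Finset.Icc (1 : ℤ) T,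
      |t₁ - t₂| < (B : ℤ) → b t₁ t₂ = 0) (l : ℕ) :
    quadFormTruncError μ e X b T l = quadFormTruncError μ e X (upperCoef b B) T l +
      quadFormTruncError μ e X (upperCoef (fun s t => b t s) B) T l := by
  funext ω
  refine sum_eq_sum_upperCoef_add hB hb (I := fun t₁ t₂ => inner ℝ (X t₁ ω) (X t₂ ω) -
      (μ[fun ω' => (inner ℝ (X t₁ ω') (X t₂ ω') : ℝ) | innovSigma e (max t₁ t₂) l]) ω)
    fun t₁ t₂ => ?_
  have : (fun ω' => (inner ℝ (X t₁ ω') (X t₂ ω') : ℝ)) = fun ω' => inner ℝ (X t₂ ω') (X t₁ ω') :=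
    funext fun _ => real_inner_comm _ _
  simp only [this, max_comm, real_inner_comm]

end Split

theorem one_add_rpow_neg_le {α x : ℝ} (hα : 0 ≤ α) (hx : 0 < x) :
    (1 + x) ^ (-α) ≤ 1 / x ^ α := by
  rw [Real.rpow_neg (by linarith), ← one_div]
  gcongr
  linarith

theorem natCast_mul_sqrt {T : ℕ} (hT : 1 ≤ T) : (T : ℝ) * √T = (T : ℝ) ^ (3 / 2 : ℝ) := by
  have : (0 : ℝ) < T := by exact_mod_cast hT
  rw [Real.sqrt_eq_rpow, ← Real.rpow_one_add' this.le (by norm_num)]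
  norm_num

theorem natCast_mul_mul_sqrt {T : ℕ} (hT : 1 ≤ T) :
    (T : ℝ) * (T * √T) = (T : ℝ) ^ (5 / 2 : ℝ) := by
  have : (0 : ℝ) < T := by exact_mod_cast hT
  rw [natCast_mul_sqrt hT, ← Real.rpow_one_add' this.le (by norm_num)]
  norm_num

end

theorem theorem1 {Ω S : Type*} [MeasurableSpace Ω] [MeasurableSpace S]
    (μ : Measure Ω) [IsProbabilityMeasure μ]
    (M α : ℝ) (hM : 4 < M) (hα : 4 < α)
    (e eDag : ℤ → Ω → S) (d : ℕ → ℕ)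
    (g : (T : ℕ) → ℤ → (ℕ → S) → EuclideanSpace ℝ (Fin (d T)))
    (hε : IsShortRangeDependent μ M α e eDag d g)
    (hd : ∃ c₁ c₂ : ℝ, 0 < c₁ ∧ 0 < c₂ ∧
      ∀ T : ℕ, 1 ≤ T → c₁ * T ≤ d T ∧ (d T : ℝ) ≤ c₂ * T) :
    (∃ C : ℝ, 0 < C ∧ ∀ (B : ℕ → ℕ) (b : ℕ → ℤ → ℤ → ℝ), IsAdmissible α B b →
      ∀ T : ℕ, 1 ≤ T →
        eLpNorm (quadForm μ (proc e (g T)) (b T) T) (ENNReal.ofReal (M / 2)) μ ≤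
          ENNReal.ofReal (C *
            (√(d T * ∑ t₁ ∈ Finset.Icc (1 : ℤ) T, ∑ t₂ ∈ Finset.Icc (1 : ℤ) T, b T t₁ t₂ ^ 2)
              + (T : ℝ) ^ (5 / 2 : ℝ) / (B T : ℝ) ^ α
              + (T : ℝ) ^ (3 / 2 : ℝ) / (B T : ℝ) ^ (α - 2)))) ∧
    (∃ C : ℝ, 0 < C ∧ ∀ (B : ℕ → ℕ) (b : ℕ → ℤ → ℤ → ℝ), IsAdmissible α B b →
      ∀ T : ℕ, 1 ≤ T → ∀ l : ℕ, B T ≤ l →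
        eLpNorm (quadFormTruncError μ e (proc e (g T)) (b T) T l)
            (ENNReal.ofReal (M / 2)) μ ≤
          ENNReal.ofReal C * (∑' q : {q : ℕ // 1 ≤ q}, depDelta μ M e eDag (g T) q *
              ENNReal.ofReal √(d T * sumSqLag (b T) T
                (fun k => max (B T : ℤ) (l + 1 - (q : ℕ)) ≤ k ∧ k ≤ l)))
          + ENNReal.ofReal (
              C * √(d T * sumSqLag (b T) T (fun k => (l : ℤ) + 1 ≤ k))
              + C * d T * (T : ℝ) ^ (3 / 2 : ℝ) / (l : ℝ) ^ (α - 1)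
              + C * d T * √(T : ℝ) / (B T : ℝ) ^ α)) := by
  obtain ⟨K, hK, hδ⟩ := exists_tail_bound hε
  obtain ⟨c₁, c₂, -, hc₂, hd⟩ := hd
  set a : ℝ := martConst (M / 2) * martConst M with ha
  have ha0 : 0 ≤ a := by positivity
  set m : ℝ := (martConst M : ℝ) ^ 2 with hm
  have hm0 : 0 ≤ m := by positivity
  constructor
  -- Two triangular halves double the main constant and the `2` of the remainder; `c₂` replaces `d`
  -- by `T`, and `1` secures positivity when `K = 0`.
  · refine ⟨2 * (a * K ^ 2) + 4 * m * K ^ 2 * c₂ + 1, by positivity, fun B b hb T hT => ?_⟩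
    have h := causalProcess_proc hM hε hT
    have hB : 0 < B T := zero_lt_one.trans (hb.one_lt T hT)
    have hB' : (0 : ℝ) < B T := by exact_mod_cast hB
    have habs := hb.abs_le_one T
    have habs' : ∀ t₁ ∈ Finset.Icc (1 : ℤ) T, ∀ t₂ ∈ Finset.Icc (1 : ℤ) T,
        |(fun s t => b T t s) t₁ t₂| ≤ 1 := fun t₁ h₁ t₂ h₂ => habs t₂ h₂ t₁ h₁
    have hu := h.eLpNorm_quadForm_upperCoef_le hK (hδ T hT) (B T) habs
    have hl := h.eLpNorm_quadForm_upperCoef_le hK (hδ T hT) (B T) habs'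
    rw [Finset.sum_comm] at hl
    rw [quadForm_eq_upperCoef_add μ (proc e (g T)) hB (hb.eq_zero T)]
    refine (eLpNorm_add_le (h.aestronglyMeasurable_quadForm _ T)
      (h.aestronglyMeasurable_quadForm _ T) h.one_le_half).trans
      ((add_le_add hu hl).trans ?_)
    rw [← ENNReal.ofReal_add (by positivity) (by positivity)]
    refine ENNReal.ofReal_le_ofReal ?_
    set R := √(d T * ∑ t₁ ∈ Finset.Icc (1 : ℤ) T, ∑ t₂ ∈ Finset.Icc (1 : ℤ) T, b T t₁ t₂ ^ 2)
    have hR : 0 ≤ R := Real.sqrt_nonneg _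
    have h3 : (d T : ℝ) * (T * √T) * (1 + B T : ℝ) ^ (-α)
        ≤ c₂ * ((T : ℝ) ^ (5 / 2 : ℝ) / (B T : ℝ) ^ α) := by
      calc _ ≤ (c₂ * T) * (T * √T) * (1 / (B T : ℝ) ^ α) := by
            gcongr
            · exact (hd T hT).2
            · exact one_add_rpow_neg_le (by linarith) hB'
        _ = _ := by
            rw [← natCast_mul_mul_sqrt hT]
            ring
    have h4 : 0 ≤ (T : ℝ) ^ (5 / 2 : ℝ) / (B T : ℝ) ^ α := by positivity
    -- This term enters only through its sign: the remainder is already covered by `T ^ (5/2) / B ^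
    -- α`.
    have h5 : 0 ≤ (T : ℝ) ^ (3 / 2 : ℝ) / (B T : ℝ) ^ (α - 2) := by positivity
    set U := (T : ℝ) ^ (5 / 2 : ℝ) / (B T : ℝ) ^ α
    set V := (T : ℝ) ^ (3 / 2 : ℝ) / (B T : ℝ) ^ (α - 2)
    have h6 := mul_le_mul_of_nonneg_left h3 (by positivity : 0 ≤ 4 * m * K ^ 2)
    have h7 : 0 ≤ a * K ^ 2 := by positivity
    have h8 : 0 ≤ 4 * m * K ^ 2 * c₂ := by positivity
    have h9 : 0 ≤ (2 * (a * K ^ 2)) * (U + V) := by positivity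
    have h10 : 0 ≤ (4 * m * K ^ 2 * c₂) * (R + V) := by positivity
    linarith
  · set Z : ℝ := ∑' q : ℕ, 1 / (1 + q : ℝ) ^ 2
    have hZ : 0 ≤ Z := tsum_nonneg fun q => by positivity
    -- The summands come in order from the near lags, the far lags, the Cauchy–Schwarz part and the
    -- remainder, each doubled for the two halves.
    set C : ℝ := 2 * (a * K) + 2 * (a * K ^ 2) + 2 * (a * K ^ 2 * Z) + 4 * m * K ^ 2 + 1 with hC
    have q1 : 0 ≤ a * K := by positivity
    have q2 : 0 ≤ a * K ^ 2 := by positivity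
    have q3 : 0 ≤ a * K ^ 2 * Z := by positivity
    have q4 : 0 ≤ m * K ^ 2 := by positivity
    refine ⟨C, by positivity, fun B b hb T hT l hBl => ?_⟩
    have h := causalProcess_proc hM hε hT
    have hB : 0 < B T := zero_lt_one.trans (hb.one_lt T hT)
    have hB' : (0 : ℝ) < B T := by exact_mod_cast hB
    have hl1 : (1 : ℝ) ≤ l := by exact_mod_cast hB.trans_le hBl
    have habs := hb.abs_le_one T
    have habs' : ∀ t₁ ∈ Finset.Icc (1 : ℤ) T, ∀ t₂ ∈ Finset.Icc (1 : ℤ) T,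
        |(fun s t => b T t s) t₁ t₂| ≤ 1 := fun t₁ h₁ t₂ h₂ => habs t₂ h₂ t₁ h₁
    have hu := h.eLpNorm_truncError_upperCoef_le hK hα (hδ T hT) hBl habs
    have hl := h.eLpNorm_truncError_upperCoef_le hK hα (hδ T hT) hBl habs'
    simp_rw [sumSqLag_swap] at hl
    rw [quadFormTruncError_eq_upperCoef_add μ e (proc e (g T)) hB (hb.eq_zero T)]
    refine (eLpNorm_add_le (h.aestronglyMeasurable_quadFormTruncError _ T l)
      (h.aestronglyMeasurable_quadFormTruncError _ T l) h.one_le_half).trans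
      ((add_le_add hu hl).trans ?_)
    rw [← two_mul, mul_add, ← mul_assoc]
    have htwo : (2 : ℝ≥0∞) = ENNReal.ofReal 2 := by simp
    rw [htwo, ← ENNReal.ofReal_mul (by norm_num), ← ENNReal.ofReal_mul (by norm_num)]
    refine add_le_add (mul_le_mul' (ENNReal.ofReal_le_ofReal (by linarith)) le_rfl)
      (ENNReal.ofReal_le_ofReal ?_)
    set R := √(d T * sumSqLag (b T) T (fun k => (l : ℤ) + 1 ≤ k))
    have hR : 0 ≤ R := Real.sqrt_nonneg _
    have h3 : (d T : ℝ) * √T * (1 + B T : ℝ) ^ (-α) ≤ d T * √T / (B T : ℝ) ^ α := by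
      rw [div_eq_mul_one_div (_ * _)]
      gcongr
      exact one_add_rpow_neg_le (by linarith) hB'
    have h4 : (d T : ℝ) * (T * √T) * (1 + (l + 1 : ℕ) : ℝ) ^ (-α)
        ≤ d T * (T : ℝ) ^ (3 / 2 : ℝ) / (l : ℝ) ^ (α - 1) := by
      rw [div_eq_mul_one_div (_ * _), natCast_mul_sqrt hT]
      gcongr
      -- The decay obtained, of order `l ^ (-α)`, is weakened to the stated `l ^ (-(α - 1))`.
      calc (1 + (l + 1 : ℕ) : ℝ) ^ (-α) ≤ (1 + (l : ℝ)) ^ (-α) :=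
            Real.rpow_le_rpow_of_nonpos (by positivity) (by push_cast; linarith) (by linarith)
        _ ≤ (1 + (l : ℝ)) ^ (-(α - 1)) :=
            Real.rpow_le_rpow_of_exponent_le (by linarith) (by linarith)
        _ ≤ _ := one_add_rpow_neg_le (by linarith) (by linarith)
    set U := (d T : ℝ) * √T * (1 + B T : ℝ) ^ (-α)
    set V := (d T : ℝ) * (T * √T) * (1 + (l + 1 : ℕ) : ℝ) ^ (-α)
    have e1 : C * d T * (T : ℝ) ^ (3 / 2 : ℝ) / (l : ℝ) ^ (α - 1)
        = C * (d T * (T : ℝ) ^ (3 / 2 : ℝ) / (l : ℝ) ^ (α - 1)) := by ring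
    have e2 : C * d T * √T / (B T : ℝ) ^ α = C * (d T * √T / (B T : ℝ) ^ α) := by ring
    rw [e1, e2]
    have hU : 0 ≤ U := by positivity
    have hV : 0 ≤ V := by positivity
    have hC0 : 0 ≤ C := by positivity
    have f1 := mul_le_mul_of_nonneg_left h3 hC0
    have f2 := mul_le_mul_of_nonneg_left h4 hC0
    have f3 : 2 * (a * K ^ 2) * R ≤ C * R := mul_le_mul_of_nonneg_right (by linarith) hR
    have f4 : 2 * (a * K ^ 2 * Z) * U ≤ C * U := mul_le_mul_of_nonneg_right (by linarith) hU
    have f5 : 4 * m * K ^ 2 * V ≤ C * V := mul_le_mul_of_nonneg_right (by linarith) hV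
    linarith
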